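/- Let $(M,g,J)$ be an almost Hermitian manifold of real dimension $2n$ (everything smooth), $\nabla$ the Levi-Civita connection of $g$, $R(X,Y)=[\nabla_X,\nabla_Y]-\nabla_{[X,Y]}$, and, for a local orthonormal frame $(e_i)$, $$s=\sum_{i,j} g(R(e_j,e_i)e_i,e_j),\qquad s^{\ast}=\sum_{i,j} g(R(e_j,e_i)Je_i,Je_j),\qquad |\nabla J|^2=\sum_{i,j}|(\nabla_{e_i}J)e_j|^2 .$$ Let $\xi_XY=-\tfrac12 J(\nabla_XJ)Y$ be the intrinsic torsion and $\chi=\sum_i\xi_{e_i}e_i$. The structure is of class - $\mathcal W_1$ if $\xi_XY=-\xi_YX$; - $\mathcal W_2$ if $g(\xi_XY,Z)+g(\xi_ZX,Y)+g(\xi_YZ,X)=0$; - $\mathcal W_3$ if $\xi_XY=\xi_{JX}(JY)$ and $\chi=0$; - $\mathcal W_4$ with Lee form $\theta$ (a smooth one-form) if $-4\xi_XY=\theta(Y)X+\theta(JY)JX-g(X,Y)\theta^\sharp-g(X,JY)J\theta^\sharp$, in each case for all $X,Y,Z$. The structure is Kähler if $\nabla J=0$, nearly Kähler if $(\nabla_XJ)X=0$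 for all $X$, almost Kähler if $d\Omega=0$ for $\Omega(X,Y)=g(X,JY)$, and locally conformally Kähler if every point has an open neighbourhood on which some metric conformal to $g$ is Kähler with respect to $J$. Then: 1. For a $\mathcal W_1$ structure $s-s^{\ast}=|\nabla J|^2$. In particular, no nearly Kähler non-Kähler structure satisfies $s=s^{\ast}$ on all of $M$. 2. For a $\mathcal W_2$ structure $2(s-s^{\ast})=-|\nabla J|^2$. In particular, no almost Kähler non-Kähler structure satisfies $s=s^{\ast}$ on all of $M$. 3. Every $\mathcal W_3$ structure satisfies $s=s^{\ast}$. 4. For a $\mathcal W_4$ structure with Lee form $\theta$ $$2(n-1)\,\mathrm{div}\,\theta^{\sharp}=-(s-s^{\ast})+(n-1)^2|\theta|^2 .$$ In particular, on a closed manifold no non-Kähler structure which is of class $\mathcal W_4$, or which is locally conformally Kähler, satisfies $s=s^{\ast}$ on all of $M$. -/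

import Mathlib

open Bundle Manifold VectorField
open scoped ContDiff

noncomputable section

namespace AlmostHermitianGeometry

variable {E : Type*} [NormedAddCommGroup E] [NormedSpace ℝ E] [FiniteDimensional ℝ E]
  {H : Type*} [TopologicalSpace H] {I : ModelWithCorners ℝ E H}
  {M : Type*} [TopologicalSpace M] [ChartedSpace H M] [IsManifold I ∞ M]

/-- A smooth Riemannian metric on the manifold `M`. -/
abbrev SmoothMetric (I : ModelWithCorners ℝ E H) (M : Type*) [TopologicalSpace M]
    [ChartedSpace H M] [IsManifold I ∞ M] :=
  ContMDiffRiemannianMetric I ∞ E (fun x : M ↦ TangentSpace I x)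

/-! ### Orthonormal frames, the Levi-Civita connection, curvature -/

/-- An orthonormal basis of `T_x M` with respect to `g`. -/
def onb (g : SmoothMetric I M) (x : M) :
    Fin (Module.finrank ℝ E) → TangentSpace I x :=
  letI : RiemannianBundle (fun x : M ↦ TangentSpace I x) := ⟨g.toRiemannianMetric⟩
  haveI : FiniteDimensional ℝ (TangentSpace I x) := inferInstanceAs (FiniteDimensional ℝ E)
  fun i ↦ stdOrthonormalBasis ℝ (TangentSpace I x) i

theorem inner_onb (g : SmoothMetric I M) (x : M) (i j : Fin (Module.finrank ℝ E)) :
    g.inner x (onb g x i) (onb g x j) = if i = j then 1 else 0 := by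
  let : RiemannianBundle (fun x : M ↦ TangentSpace I x) := ⟨g.toRiemannianMetric⟩
  have : FiniteDimensional ℝ (TangentSpace I x) := inferInstanceAs (FiniteDimensional ℝ E)
  exact orthonormal_iff_ite.1 (stdOrthonormalBasis ℝ (TangentSpace I x)).orthonormal i j

/-- The derivative `X (g(Y, Z))` at `x`. -/
def derivInner (g : SmoothMetric I M) (X Y Z : Π x : M, TangentSpace I x) (x : M) : ℝ :=
  mvfderiv I (fun y ↦ g.inner y (Y y) (Z y)) x (X x)

/-- The right-hand side of the Koszul formula for `g(∇_X Y, Z)`. -/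
def koszul (g : SmoothMetric I M) (X Y Z : Π x : M, TangentSpace I x) (x : M) : ℝ :=
  (derivInner g X Y Z x + derivInner g Y Z X x - derivInner g Z X Y x
    + g.inner x (mlieBracket I X Y x) (Z x)
    - g.inner x (mlieBracket I X Z x) (Y x)
    - g.inner x (mlieBracket I Y Z x) (X x)) / 2

/-- The Levi-Civita connection of `g`: `nabla g Y x v` is `∇_v Y ∈ T_x M`, the tangent vector whose
inner product with every `w` is given by the Koszul formula. -/
def nabla (g : SmoothMetric I M) (Y : Π x : M, TangentSpace I x) (x : M)
    (v : TangentSpace I x) : TangentSpace I x :=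
  ∑ i, koszul g (FiberBundle.extend E v) Y (FiberBundle.extend E (onb g x i)) x • onb g x i

/-- The covariant derivative of vector fields `∇_X Y`. -/
def nablaField (g : SmoothMetric I M) (X Y : Π x : M, TangentSpace I x) :
    Π x : M, TangentSpace I x :=
  fun x ↦ nabla g Y x (X x)

/-- The curvature `R(X, Y) Z = ∇_X ∇_Y Z - ∇_Y ∇_X Z - ∇_{[X, Y]} Z` of vector fields. -/
def curvatureField (g : SmoothMetric I M) (X Y Z : Π x : M, TangentSpace I x) :
    Π x : M, TangentSpace I x :=
  fun x ↦ nablaField g X (nablaField g Y Z) x - nablaField g Y (nablaField g X Z) x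
    - nablaField g (mlieBracket I X Y) Z x

/-- The curvature tensor `R(u, v) w` at `x`, computed with local extensions of `u, v, w`. -/
def curvature (g : SmoothMetric I M) (x : M) (u v w : TangentSpace I x) : TangentSpace I x :=
  curvatureField g (FiberBundle.extend E u) (FiberBundle.extend E v) (FiberBundle.extend E w) x

/-- The divergence of a vector field with respect to `g`. -/
def divergence (g : SmoothMetric I M) (X : Π x : M, TangentSpace I x) (x : M) : ℝ :=
  ∑ i, g.inner x (nabla g X x (onb g x i)) (onb g x i)

/-! ### One-forms -/

/-- The vector field `θ^♯` dual to a one-form `θ`. -/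
def sharp (g : SmoothMetric I M) (θ : Π x : M, TangentSpace I x →L[ℝ] ℝ) :
    Π x : M, TangentSpace I x :=
  fun x ↦ ∑ i, θ x (onb g x i) • onb g x i

/-- `|θ|²`. -/
def oneFormNormSq (g : SmoothMetric I M) (θ : Π x : M, TangentSpace I x →L[ℝ] ℝ) (x : M) : ℝ :=
  ∑ i, θ x (onb g x i) ^ 2

/-- Smoothness of a one-form, as a section of `T*M`. -/
def IsSmoothOneForm (θ : Π x : M, TangentSpace I x →L[ℝ] ℝ) : Prop :=
  ContMDiff I (I.prod 𝓘(ℝ, E →L[ℝ] ℝ)) ∞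
    (fun x ↦ (TotalSpace.mk' (E →L[ℝ] ℝ) x (θ x) :
      TotalSpace (E →L[ℝ] ℝ) (fun x : M ↦ TangentSpace I x →L[ℝ] ℝ)))

/-! ### Almost Hermitian structures -/

/-- An almost complex structure which is smooth and orthogonal with respect to `g`,
i.e. `(M, g, J)` is an almost Hermitian manifold. -/
structure HermitianStructure (g : SmoothMetric I M) where
  /-- The almost complex structure. -/
  J : Π x : M, TangentSpace I x →L[ℝ] TangentSpace I x
  smooth : ContMDiff I (I.prod 𝓘(ℝ, E →L[ℝ] E)) ∞
    (fun x ↦ (TotalSpace.mk' (E →L[ℝ] E) x (J x) :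
      TotalSpace (E →L[ℝ] E) (fun x : M ↦ TangentSpace I x →L[ℝ] TangentSpace I x)))
  sq : ∀ (x : M) (v : TangentSpace I x), J x (J x v) = -v
  orthogonal : ∀ (x : M) (v w : TangentSpace I x), g.inner x (J x v) (J x w) = g.inner x v w

/-- `(∇_v J) w = ∇_v (J W) - J (∇_v W)`, where `W` is a local extension of `w` and `∇` is the
Levi-Civita connection of `g`. -/
def nablaJ (g : SmoothMetric I M) (J : Π x : M, TangentSpace I x →L[ℝ] TangentSpace I x) (x : M)
    (v w : TangentSpace I x) : TangentSpace I x :=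
  nabla g (fun y ↦ J y (FiberBundle.extend E w y)) x v
    - J x (nabla g (FiberBundle.extend E w) x v)

/-- `|∇J|²`. -/
def nablaJNormSq (g : SmoothMetric I M)
    (J : Π x : M, TangentSpace I x →L[ℝ] TangentSpace I x) (x : M) : ℝ :=
  ∑ i, ∑ j, g.inner x (nablaJ g J x (onb g x i) (onb g x j))
    (nablaJ g J x (onb g x i) (onb g x j))

/-- The scalar curvature `s = ∑ g(R(e_j, e_i) e_i, e_j)`. -/
def scal (g : SmoothMetric I M) (x : M) : ℝ :=
  ∑ j, ∑ i, g.inner x (curvature g x (onb g x j) (onb g x i) (onb g x i)) (onb g x j)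

/-- The `*`-scalar curvature `s* = ∑ g(R(e_j, e_i) J e_i, J e_j)`. -/
def scalStar (g : SmoothMetric I M)
    (J : Π x : M, TangentSpace I x →L[ℝ] TangentSpace I x) (x : M) : ℝ :=
  ∑ j, ∑ i, g.inner x (curvature g x (onb g x j) (onb g x i) (J x (onb g x i)))
    (J x (onb g x j))

namespace HermitianStructure

variable {g : SmoothMetric I M} (S : HermitianStructure g)

/-- The intrinsic torsion `ξ_v w = -(1/2) J (∇_v J) w`, i.e. the difference between the induced
unitary connection and the Levi-Civita connection. -/
def torsion (x : M) (v w : TangentSpace I x) : TangentSpace I x :=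
  (-(1 / 2) : ℝ) • S.J x (nablaJ g S.J x v w)

/-- The characteristic vector field `χ = ∑ ξ_{e_i} e_i`. -/
def chi (x : M) : TangentSpace I x :=
  ∑ i, S.torsion x (onb g x i) (onb g x i)

/-- Gray-Hervella class `𝒲₁`. -/
def IsW1 : Prop :=
  ∀ (x : M) (v w : TangentSpace I x), S.torsion x v w = -S.torsion x w v

/-- Gray-Hervella class `𝒲₂`. -/
def IsW2 : Prop :=
  ∀ (x : M) (u v w : TangentSpace I x),
    g.inner x (S.torsion x u v) w + g.inner x (S.torsion x w u) v
      + g.inner x (S.torsion x v w) u = 0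

/-- Gray-Hervella class `𝒲₃`. -/
def IsW3 : Prop :=
  (∀ (x : M) (v w : TangentSpace I x),
    S.torsion x v w = S.torsion x (S.J x v) (S.J x w)) ∧ ∀ x : M, S.chi x = 0

/-- Gray-Hervella class `𝒲₄`, with Lee form `θ`. -/
def IsW4With (θ : Π x : M, TangentSpace I x →L[ℝ] ℝ) : Prop :=
  IsSmoothOneForm θ ∧ ∀ (x : M) (v w : TangentSpace I x),
    (-4 : ℝ) • S.torsion x v w =
      θ x w • v + θ x (S.J x w) • S.J x v - g.inner x v w • sharp g θ x
        - g.inner x v (S.J x w) • S.J x (sharp g θ x)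

/-- Gray-Hervella class `𝒲₄`. -/
def IsW4 : Prop := ∃ θ : Π x : M, TangentSpace I x →L[ℝ] ℝ, S.IsW4With θ

/-- The curvature condition `s = s*` on all of `M`. -/
def IsSC : Prop := ∀ x : M, scal g x = scalStar g S.J x

/-- Kähler structures: `∇J = 0`. -/
def IsKahler : Prop := ∀ (x : M) (v w : TangentSpace I x), nablaJ g S.J x v w = 0

/-- Nearly Kähler structures: `(∇_X J) X = 0`. -/
def IsNearlyKahler : Prop := ∀ (x : M) (v : TangentSpace I x), nablaJ g S.J x v v = 0

/-- The Kähler form `Ω(v, w) = g(v, J w)`. -/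
def kahlerForm (x : M) (v w : TangentSpace I x) : ℝ := g.inner x v (S.J x w)

/-- The exterior derivative of the Kähler form, evaluated on vector fields. -/
def dKahlerForm (X Y Z : Π x : M, TangentSpace I x) (x : M) : ℝ :=
  mvfderiv I (fun y ↦ S.kahlerForm y (Y y) (Z y)) x (X x)
    + mvfderiv I (fun y ↦ S.kahlerForm y (Z y) (X y)) x (Y x)
    + mvfderiv I (fun y ↦ S.kahlerForm y (X y) (Y y)) x (Z x)
    - S.kahlerForm x (mlieBracket I X Y x) (Z x)
    - S.kahlerForm x (mlieBracket I Y Z x) (X x)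
    - S.kahlerForm x (mlieBracket I Z X x) (Y x)

/-- Almost Kähler structures: `dΩ = 0`. -/
def IsAlmostKahler : Prop :=
  ∀ (x : M) (u v w : TangentSpace I x),
    S.dKahlerForm (FiberBundle.extend E u) (FiberBundle.extend E v) (FiberBundle.extend E w) x = 0

/-- Locally conformally Kähler structures: every point has an open neighbourhood `U` on which a
metric conformal to `g` is Kähler with respect to `J`. Since a smooth function on a neighbourhood
of a point can be replaced by one defined on all of `M` which agrees with it near that point, the
conformal factor is taken to be globally defined; nothing is required of `g'` outside `U`. -/
def IsLCK : Prop :=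
  ∀ x : M, ∃ (U : Set M) (f : M → ℝ) (g' : SmoothMetric I M),
    IsOpen U ∧ x ∈ U ∧ ContMDiff I 𝓘(ℝ, ℝ) ∞ f ∧
    (∀ (y : M) (v w : TangentSpace I y), g'.inner y v w = Real.exp (f y) * g.inner y v w) ∧
    ∀ y ∈ U, ∀ v w : TangentSpace I y, nablaJ g' S.J y v w = 0

end HermitianStructure

end AlmostHermitianGeometry

end

open Bundle Manifold VectorField
open scoped ContDiff

noncomputable section

set_option linter.unusedSectionVars false

namespace AlmostHermitianGeometry

/-! Write `A = ∇J`, let `e` be an orthonormal frame, and put `V = ∑ A(e_i) e_i` and `Q = ∑ g(A(e_i)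
e_j, A(e_j) e_i)`. All four parts follow from one identity, `HermitianStructure.scal_sub_scalStar`:
`s - s* = 2 div(JV) + |V|² - Q`. The curvature enters `s - s*` only through the commutator of
`R(e_j, e_i)` with `J`, which the Ricci identity turns into the antisymmetrised second derivative of
`J`. One of the two resulting terms contracts at once to a derivative of `V`. The other does so
after using that `∇²J` is skew and differentiating `J² = -1` twice, which produces the terms
quadratic in `A`.

What remains is algebra at a point. In `𝒲₁`, `A` is alternating, so `V = 0` and `Q = -|A|²`. In
`𝒲₂`, cyclicity forces `A(J·)J· = -A`, hence `V = 0`, and `2Q = |A|²`. In `𝒲₃` and `𝒲₄`, `A(J·)J· =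
A`, so `Q` changes sign when `e_j` is replaced by `J e_j` and vanishes; `V` is zero in `𝒲₃`, while
`JV = -(n-1) θ^♯` in `𝒲₄`. Nearly Kähler structures are `𝒲₁` by polarisation. Almost Kähler
structures are `𝒲₂` because `dΩ` is minus the cyclic sum of `A`.

On a closed manifold with `s = s*`, the nonnegative function `(n-1)²|θ|²` is a constant times a
divergence, so it integrates to zero and vanishes; then `|A|² = 2(n-1)|θ|²` vanishes too. In the
locally conformally Kähler case the conformal change formula gives `A` the `𝒲₄` shape at each point.
The Lee vectors may be chosen pointwise, without smoothness, because the divergence theorem is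
applied to `JV`, which is smooth and depends only on `g` and `J`.

Differential identities are proved for metrics on open sets of a vector space and carried to the
manifold by coordinate frames. The divergence theorem is obtained from integration by parts in
charts and a partition of unity. -/

/-- The family `e` is an orthonormal basis with respect to the symmetric bilinear form `b`. -/
structure IsOrthonormalBasis {V ι : Type*} [AddCommGroup V] [Module ℝ V] [TopologicalSpace V]
    [Fintype ι] [DecidableEq ι] (b : V →L[ℝ] V →L[ℝ] ℝ) (e : ι → V) : Prop where
  inner_eq : ∀ i j, b (e i) (e j) = if i = j then 1 else 0
  sum_eq : ∀ v, ∑ i, b v (e i) • e i = v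

/-! ### Riemannian geometry in coordinates -/

namespace Coord

variable {E : Type*} [NormedAddCommGroup E] [NormedSpace ℝ E]

/-! Shortcut instances for iterated spaces of continuous linear maps. -/

instance instNormedAddCommGroupBilin : NormedAddCommGroup (E →L[ℝ] E →L[ℝ] ℝ) := inferInstance

instance instNormedSpaceBilin : NormedSpace ℝ (E →L[ℝ] E →L[ℝ] ℝ) := inferInstance

instance instNormedAddCommGroupTrilin : NormedAddCommGroup (E →L[ℝ] E →L[ℝ] E →L[ℝ] ℝ) :=
  inferInstance

instance instNormedSpaceTrilin : NormedSpace ℝ (E →L[ℝ] E →L[ℝ] E →L[ℝ] ℝ) := inferInstance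

instance instAddCommGroupBilin : AddCommGroup (E →L[ℝ] E →L[ℝ] ℝ) := inferInstance

instance instAddMonoidBilin : AddMonoid (E →L[ℝ] E →L[ℝ] ℝ) := inferInstance

/-- The lowered Christoffel symbols of the metric `G`. -/
def christoffelForm (G : E → E →L[ℝ] E →L[ℝ] ℝ) (p : E) : E →L[ℝ] E →L[ℝ] E →L[ℝ] ℝ :=
  (1 / 2 : ℝ) • (fderiv ℝ G p + (fderiv ℝ G p).flip -
    (ContinuousLinearMap.flipₗᵢ ℝ E E ℝ).toContinuousLinearEquiv.toContinuousLinearMap ∘L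
      (fderiv ℝ G p).flip)

/-- The Christoffel symbols of the metric `G`. -/
def christoffel (G : E → E →L[ℝ] E →L[ℝ] ℝ) (p : E) : E →L[ℝ] E →L[ℝ] E :=
  (ContinuousLinearMap.compL ℝ E (E →L[ℝ] ℝ) E (G p).inverse) ∘L christoffelForm G p

/-- The covariant derivative of the vector field `Y` in the direction `v`. -/
def cov (G : E → E →L[ℝ] E →L[ℝ] ℝ) (Y : E → E) (p v : E) : E :=
  fderiv ℝ Y p v + christoffel G p v (Y p)

theorem cov_congr (G : E → E →L[ℝ] E →L[ℝ] ℝ) {Y Z : E → E} {p : E} (h : Y =ᶠ[nhds p] Z) (v : E) :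
    cov G Y p v = cov G Z p v := by
  rw [cov, cov, h.fderiv_eq, h.eq_of_nhds]

/-- The curvature tensor in terms of the Christoffel symbols. -/
def curv (G : E → E →L[ℝ] E →L[ℝ] ℝ) (p u v w : E) : E :=
  fderiv ℝ (christoffel G) p u v w - fderiv ℝ (christoffel G) p v u w
    + christoffel G p u (christoffel G p v w) - christoffel G p v (christoffel G p u w)

/-- The covariant derivative `(v, w) ↦ (∇_v J) w` of an endomorphism field. -/
def covEnd (G : E → E →L[ℝ] E →L[ℝ] ℝ) (J : E → E →L[ℝ] E) (p : E) : E →L[ℝ] E →L[ℝ] E :=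
  fderiv ℝ J p + ((ContinuousLinearMap.compL ℝ E E E).flip (J p)) ∘L christoffel G p
    - (ContinuousLinearMap.compL ℝ E E E (J p)) ∘L christoffel G p

/-- The second covariant derivative `(∇²_{u, v} J) w` of an endomorphism field. -/
def covEnd₂ (G : E → E →L[ℝ] E →L[ℝ] ℝ) (J : E → E →L[ℝ] E) (p u v w : E) : E :=
  fderiv ℝ (covEnd G J) p u v w + christoffel G p u (covEnd G J p v w)
    - covEnd G J p (christoffel G p u v) w - covEnd G J p v (christoffel G p u w)

theorem covEnd_apply (G : E → E →L[ℝ] E →L[ℝ] ℝ) (J : E → E →L[ℝ] E) (p v w : E) :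
    covEnd G J p v w = fderiv ℝ J p v w + christoffel G p v (J p w) - J p (christoffel G p v w) :=
  rfl

theorem christoffelForm_apply (G : E → E →L[ℝ] E →L[ℝ] ℝ) (p a b c : E) :
    christoffelForm G p a b c =
      (1 / 2 : ℝ) * (fderiv ℝ G p a b c + fderiv ℝ G p b a c - fderiv ℝ G p c a b) := rfl

/-- A smooth Riemannian metric on an open subset of a vector space. -/
structure IsMetricOn (G : E → E →L[ℝ] E →L[ℝ] ℝ) (U : Set E) : Prop where
  isOpen : IsOpen U
  contDiffAt : ∀ p ∈ U, ContDiffAt ℝ ∞ G p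
  symm : ∀ p ∈ U, ∀ v w, G p v w = G p w v
  pos : ∀ p ∈ U, ∀ v, v ≠ 0 → 0 < G p v v

/-- A smooth orthogonal almost complex structure on an open subset of a vector space. -/
structure IsHermitianOn (G : E → E →L[ℝ] E →L[ℝ] ℝ) (J : E → E →L[ℝ] E) (U : Set E) : Prop where
  contDiffAt : ∀ p ∈ U, ContDiffAt ℝ ∞ J p
  sq : ∀ p ∈ U, ∀ v, J p (J p v) = -v
  orthogonal : ∀ p ∈ U, ∀ v w, G p (J p v) (J p w) = G p v w

namespace IsMetricOn

variable [FiniteDimensional ℝ E] {G : E → E →L[ℝ] E →L[ℝ] ℝ} {U : Set E}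

omit [FiniteDimensional ℝ E] in
theorem differentiableAt (hG : IsMetricOn G U) {p : E} (hp : p ∈ U) : DifferentiableAt ℝ G p :=
  (hG.contDiffAt p hp).differentiableAt (by simp)

/-- Positivity makes the map to the dual injective, and the dual has the same finite dimension. -/
theorem isInvertible (hG : IsMetricOn G U) {p : E} (hp : p ∈ U) : (G p).IsInvertible := by
  have hinj : Function.Injective (G p).toLinearMap := by
    rw [← LinearMap.ker_eq_bot, LinearMap.ker_eq_bot']
    intro v hv
    by_contra hne
    have := hG.pos p hp v hne
    rw [show G p v = 0 from hv] at this
    simp at this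
  have hdim : Module.finrank ℝ E = Module.finrank ℝ (E →L[ℝ] ℝ) := by
    rw [← (LinearMap.toContinuousLinearMap (𝕜 := ℝ) (E := E) (F' := ℝ)).finrank_eq]
    exact (Subspace.dual_finrank_eq (K := ℝ) (V := E)).symm
  let e := (LinearEquiv.ofInjectiveOfFinrankEq (G p).toLinearMap hinj hdim).toContinuousLinearEquiv
  refine ⟨e, ?_⟩
  ext v w
  rfl

theorem apply_inverse (hG : IsMetricOn G U) {p : E} (hp : p ∈ U) (α : E →L[ℝ] ℝ) :
    G p ((G p).inverse α) = α :=
  (hG.isInvertible hp).self_apply_inverse α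

theorem ext_inner (hG : IsMetricOn G U) {p : E} (hp : p ∈ U) {v w : E}
    (h : ∀ z, G p v z = G p w z) : v = w :=
  (hG.isInvertible hp).injective (ContinuousLinearMap.ext h)

theorem inner_christoffel (hG : IsMetricOn G U) {p : E} (hp : p ∈ U) (a b c : E) :
    G p (christoffel G p a b) c =
      (1 / 2 : ℝ) * (fderiv ℝ G p a b c + fderiv ℝ G p b a c - fderiv ℝ G p c a b) := by
  rw [← christoffelForm_apply]
  exact congrArg (fun α : E →L[ℝ] ℝ ↦ α c) (hG.apply_inverse hp (christoffelForm G p a b))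

omit [FiniteDimensional ℝ E] in
theorem fderiv_inner (hG : IsMetricOn G U) {p : E} (hp : p ∈ U) {Y Z : E → E}
    (hY : DifferentiableAt ℝ Y p) (hZ : DifferentiableAt ℝ Z p) (v : E) :
    fderiv ℝ (fun q ↦ G q (Y q) (Z q)) p v =
      fderiv ℝ G p v (Y p) (Z p) + G p (fderiv ℝ Y p v) (Z p) + G p (Y p) (fderiv ℝ Z p v) := by
  have := ((hG.differentiableAt hp).hasFDerivAt.clm_apply hY.hasFDerivAt).clm_apply hZ.hasFDerivAt
  rw [this.fderiv]
  simp
  ring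

omit [FiniteDimensional ℝ E] in
-- Symmetry of `G` holds on a neighbourhood, so it can be differentiated on constant fields.
theorem fderiv_symm (hG : IsMetricOn G U) {p : E} (hp : p ∈ U) (v a b : E) :
    fderiv ℝ G p v a b = fderiv ℝ G p v b a := by
  have h1 := hG.fderiv_inner hp (differentiableAt_const a) (differentiableAt_const b) v
  have h2 := hG.fderiv_inner hp (differentiableAt_const b) (differentiableAt_const a) v
  have h3 : (fun q ↦ G q a b) =ᶠ[nhds p] fun q ↦ G q b a := by
    filter_upwards [hG.isOpen.mem_nhds hp] with q hq using hG.symm q hq a b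
  rw [h3.fderiv_eq, h2] at h1
  simpa using h1.symm

theorem christoffel_symm (hG : IsMetricOn G U) {p : E} (hp : p ∈ U) (a b : E) :
    christoffel G p a b = christoffel G p b a := by
  apply hG.ext_inner hp
  intro z
  rw [hG.inner_christoffel hp, hG.inner_christoffel hp, hG.fderiv_symm hp z a b]
  ring

/-- This is `∇G = 0` tested on constant fields: in the sum of the two Christoffel expressions all
but the derivative along `v` cancels. -/
theorem fderiv_eq (hG : IsMetricOn G U) {p : E} (hp : p ∈ U) (v a b : E) :
    fderiv ℝ G p v a b = G p (christoffel G p v a) b + G p a (christoffel G p v b) := by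
  rw [hG.symm p hp a, hG.inner_christoffel hp, hG.inner_christoffel hp, hG.fderiv_symm hp v a b,
    hG.fderiv_symm hp a v b, hG.fderiv_symm hp b v a]
  ring

theorem contDiffAt_inverse (hG : IsMetricOn G U) {p : E} (hp : p ∈ U) :
    ContDiffAt ℝ ∞ (fun q ↦ (G q).inverse) p :=
  ((hG.isInvertible hp).contDiffAt_map_inverse).comp p (hG.contDiffAt p hp)

theorem contDiffAt_christoffel (hG : IsMetricOn G U) {p : E} (hp : p ∈ U) :
    ContDiffAt ℝ ∞ (christoffel G) p := by
  have hD : ContDiffAt ℝ ∞ (fderiv ℝ G) p := (hG.contDiffAt p hp).fderiv_right (by simp)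
  have hflip : ContDiffAt ℝ ∞ (fun q ↦ (fderiv ℝ G q).flip) p :=
    ((ContinuousLinearMap.flipₗᵢ ℝ E E (E →L[ℝ] ℝ)).contDiff.contDiffAt).comp p hD
  have hform : ContDiffAt ℝ ∞ (christoffelForm G) p :=
    ((hD.add hflip).sub (contDiffAt_const.clm_comp hflip)).const_smul _
  exact ((ContinuousLinearMap.contDiff _).contDiffAt.comp p
    (hG.contDiffAt_inverse hp)).clm_comp hform

theorem differentiableAt_christoffel (hG : IsMetricOn G U) {p : E} (hp : p ∈ U) :
    DifferentiableAt ℝ (christoffel G) p :=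
  (hG.contDiffAt_christoffel hp).differentiableAt (by simp)

/-- The Koszul formula. -/
theorem koszul_eq (hG : IsMetricOn G U) {p : E} (hp : p ∈ U) {X Y Z : E → E}
    (hX : DifferentiableAt ℝ X p) (hY : DifferentiableAt ℝ Y p) (hZ : DifferentiableAt ℝ Z p) :
    (fderiv ℝ (fun q ↦ G q (Y q) (Z q)) p (X p) + fderiv ℝ (fun q ↦ G q (Z q) (X q)) p (Y p)
      - fderiv ℝ (fun q ↦ G q (X q) (Y q)) p (Z p)
      + G p (lieBracket ℝ X Y p) (Z p) - G p (lieBracket ℝ X Z p) (Y p)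
      - G p (lieBracket ℝ Y Z p) (X p)) / 2 = G p (cov G Y p (X p)) (Z p) := by
  rw [hG.fderiv_inner hp hY hZ, hG.fderiv_inner hp hZ hX, hG.fderiv_inner hp hX hY,
    cov]
  simp only [lieBracket_eq, map_sub, map_add, sub_apply,
    add_apply]
  rw [hG.inner_christoffel hp, hG.symm p hp (fderiv ℝ Z p (Y p)) (X p),
    hG.symm p hp (fderiv ℝ X p (Z p)) (Y p),
    hG.symm p hp (fderiv ℝ Z p (X p)) (Y p), hG.fderiv_symm hp (Y p) (Z p),
    hG.symm p hp (Z p) (fderiv ℝ X p (Y p)), hG.symm p hp (X p) (fderiv ℝ Y p (Z p))]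
  ring

theorem fderiv_cov (hG : IsMetricOn G U) {p : E} (hp : p ∈ U) {Y Z : E → E}
    (hY : ContDiffAt ℝ ∞ Y p) (hZ : ContDiffAt ℝ ∞ Z p) (v : E) :
    fderiv ℝ (fun q ↦ cov G Z q (Y q)) p v =
      fderiv ℝ (fderiv ℝ Z) p v (Y p) + fderiv ℝ Z p (fderiv ℝ Y p v)
        + fderiv ℝ (christoffel G) p v (Y p) (Z p) + christoffel G p (fderiv ℝ Y p v) (Z p)
        + christoffel G p (Y p) (fderiv ℝ Z p v) := by
  have hY' := (hY.differentiableAt (by simp)).hasFDerivAt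
  have hZ' := (hZ.differentiableAt (by simp)).hasFDerivAt
  have hDZ : HasFDerivAt (fderiv ℝ Z) (fderiv ℝ (fderiv ℝ Z) p) p :=
    ((hZ.fderiv_right (m := ∞) (by simp)).differentiableAt (by simp)).hasFDerivAt
  have := (hDZ.clm_apply hY').add
    (((hG.differentiableAt_christoffel hp).hasFDerivAt.clm_apply hY').clm_apply hZ')
  rw [show (fun q ↦ cov G Z q (Y q)) =
    (fun q ↦ fderiv ℝ Z q (Y q)) + fun q ↦ christoffel G q (Y q) (Z q) from rfl, this.fderiv]
  simp
  abel

/-- Second derivatives of `Z` cancel by symmetry, and first derivatives of `X` and `Y` are absorbed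
by the Lie bracket, so only a pointwise expression survives. -/
theorem curvature_eq (hG : IsMetricOn G U) {p : E} (hp : p ∈ U) {X Y Z : E → E}
    (hX : ContDiffAt ℝ ∞ X p) (hY : ContDiffAt ℝ ∞ Y p) (hZ : ContDiffAt ℝ ∞ Z p) :
    cov G (fun q ↦ cov G Z q (Y q)) p (X p) - cov G (fun q ↦ cov G Z q (X q)) p (Y p)
      - cov G Z p (lieBracket ℝ X Y p) = curv G p (X p) (Y p) (Z p) := by
  have hsymm : fderiv ℝ (fderiv ℝ Z) p (X p) (Y p) = fderiv ℝ (fderiv ℝ Z) p (Y p) (X p) :=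
    (hZ.isSymmSndFDerivAt (by simpa using ENat.LEInfty.out)) _ _
  rw [cov, hG.fderiv_cov hp hY hZ, cov.eq_1 G (fun q ↦ cov G Z q (X q)) p (Y p), hG.fderiv_cov hp hX hZ]
  simp only [cov, curv, lieBracket_eq, map_sub, map_add, sub_apply, hsymm]
  abel

end IsMetricOn

end Coord

end AlmostHermitianGeometry

/-! ### First and second covariant derivatives of an almost complex structure in coordinates -/

namespace AlmostHermitianGeometry

namespace Coord

set_option synthInstance.maxHeartbeats 400000

variable {E : Type*} [NormedAddCommGroup E] [NormedSpace ℝ E] [FiniteDimensional ℝ E]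
  {G : E → E →L[ℝ] E →L[ℝ] ℝ} {J : E → E →L[ℝ] E} {U : Set E}

namespace IsHermitianOn

omit [FiniteDimensional ℝ E] in
theorem differentiableAt (hJ : IsHermitianOn G J U) {p : E} (hp : p ∈ U) :
    DifferentiableAt ℝ J p :=
  (hJ.contDiffAt p hp).differentiableAt (by simp)

omit [FiniteDimensional ℝ E] in
theorem inner_left (hJ : IsHermitianOn G J U) {p : E} (hp : p ∈ U) (v w : E) :
    G p (J p v) w = -G p v (J p w) := by
  have := hJ.orthogonal p hp v (J p w)
  rw [hJ.sq p hp, map_neg] at this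
  linarith

theorem contDiffAt_covEnd (hG : IsMetricOn G U) (hJ : IsHermitianOn G J U) {p : E} (hp : p ∈ U) :
    ContDiffAt ℝ ∞ (covEnd G J) p := by
  have h1 : ContDiffAt ℝ ∞ (fderiv ℝ J) p := (hJ.contDiffAt p hp).fderiv_right (by simp)
  have h2 := hG.contDiffAt_christoffel hp
  have h3 : ContDiffAt ℝ ∞ (fun q ↦ ((ContinuousLinearMap.compL ℝ E E E).flip (J q))) p :=
    (ContinuousLinearMap.contDiff _).contDiffAt.comp p (hJ.contDiffAt p hp)
  have h4 : ContDiffAt ℝ ∞ (fun q ↦ ((ContinuousLinearMap.compL ℝ E E E) (J q))) p :=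
    (ContinuousLinearMap.contDiff _).contDiffAt.comp p (hJ.contDiffAt p hp)
  exact (h1.add (h3.clm_comp h2)).sub (h4.clm_comp h2)

theorem differentiableAt_covEnd (hG : IsMetricOn G U) (hJ : IsHermitianOn G J U) {p : E}
    (hp : p ∈ U) : DifferentiableAt ℝ (covEnd G J) p :=
  (contDiffAt_covEnd hG hJ hp).differentiableAt (by simp)

theorem fderiv_covEnd (hG : IsMetricOn G U) (hJ : IsHermitianOn G J U) {p : E} (hp : p ∈ U)
    (u v w : E) :
    fderiv ℝ (covEnd G J) p u v w =
      fderiv ℝ (fderiv ℝ J) p u v w + fderiv ℝ (christoffel G) p u v (J p w)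
        + christoffel G p v (fderiv ℝ J p u w) - fderiv ℝ J p u (christoffel G p v w)
        - J p (fderiv ℝ (christoffel G) p u v w) := by
  have hΓ := (hG.differentiableAt_christoffel hp).hasFDerivAt
  have hJ' := (hJ.differentiableAt hp).hasFDerivAt
  have hDJ : HasFDerivAt (fderiv ℝ J) (fderiv ℝ (fderiv ℝ J) p) p :=
    (((hJ.contDiffAt p hp).fderiv_right (m := ∞) (by simp)).differentiableAt (by simp)).hasFDerivAt
  have hv := hasFDerivAt_const (𝕜 := ℝ) v p
  have hw := hasFDerivAt_const (𝕜 := ℝ) w p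
  have h1 := ((hDJ.clm_apply hv).clm_apply hw).add
    ((hΓ.clm_apply hv).clm_apply (hJ'.clm_apply hw))
  have h2 := h1.sub (hJ'.clm_apply ((hΓ.clm_apply hv).clm_apply hw))
  have h3 := (((differentiableAt_covEnd hG hJ hp).hasFDerivAt.clm_apply hv).clm_apply hw)
  have := congrArg (fun L : E →L[ℝ] E ↦ L u) (h3.unique h2)
  simp at this
  rw [this]
  abel

/-- The Ricci identity for `J`. -/
theorem covEnd₂_sub (hG : IsMetricOn G U) (hJ : IsHermitianOn G J U) {p : E} (hp : p ∈ U)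
    (u v w : E) :
    covEnd₂ G J p u v w - covEnd₂ G J p v u w = curv G p u v (J p w) - J p (curv G p u v w) := by
  -- With this and the symmetry of the Christoffel symbols, the antisymmetrisation loses every
  -- derivative of `J` and only curvature terms remain.
  have hsymm : fderiv ℝ (fderiv ℝ J) p u v = fderiv ℝ (fderiv ℝ J) p v u :=
    ((hJ.contDiffAt p hp).isSymmSndFDerivAt (by simpa using ENat.LEInfty.out)) _ _
  simp only [covEnd₂, fderiv_covEnd hG hJ hp, covEnd_apply, curv, hsymm, map_add, map_sub,
    hG.christoffel_symm hp u v]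
  abel

/-- Differentiate `G(J w, z) = -G(w, J z)` for constant `w` and `z`; metric compatibility supplies
exactly the Christoffel terms of `covEnd`. -/
theorem inner_covEnd (hG : IsMetricOn G U) (hJ : IsHermitianOn G J U) {p : E} (hp : p ∈ U)
    (v w z : E) : G p (covEnd G J p v w) z = -G p w (covEnd G J p v z) := by
  have h1 := hG.fderiv_inner hp ((hJ.differentiableAt hp).clm_apply (differentiableAt_const w))
    (differentiableAt_const z) v
  have h2 := hG.fderiv_inner hp (differentiableAt_const w)
    ((hJ.differentiableAt hp).clm_apply (differentiableAt_const z)) v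
  have h3 : (fun q ↦ G q (J q w) z) =ᶠ[nhds p] fun q ↦ -G q w (J q z) := by
    filter_upwards [hG.isOpen.mem_nhds hp] with q hq using hJ.inner_left hq w z
  have hw := hasFDerivAt_const (𝕜 := ℝ) w p
  have hz := hasFDerivAt_const (𝕜 := ℝ) z p
  rw [h3.fderiv_eq, fderiv_fun_neg, neg_apply, h2,
    ((hJ.differentiableAt hp).hasFDerivAt.clm_apply hw).fderiv,
    ((hJ.differentiableAt hp).hasFDerivAt.clm_apply hz).fderiv] at h1
  simp [hG.fderiv_eq hp] at h1
  simp only [covEnd_apply, map_add, map_sub, add_apply, sub_apply]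
  rw [hJ.inner_left hp (christoffel G p v w) z]
  have h4 := hJ.inner_left hp w (christoffel G p v z)
  linarith

omit [FiniteDimensional ℝ E] in
-- This is the derivative of `J² = -1`; the Christoffel terms match on both sides.
theorem covEnd_anti (hG : IsMetricOn G U) (hJ : IsHermitianOn G J U) {p : E} (hp : p ∈ U)
    (v w : E) : covEnd G J p v (J p w) = -J p (covEnd G J p v w) := by
  have hJ' := (hJ.differentiableAt hp).hasFDerivAt
  have hw := hasFDerivAt_const (𝕜 := ℝ) w p
  have h1 := hJ'.clm_apply (hJ'.clm_apply hw)
  have h3 : (fun q ↦ J q (J q w)) =ᶠ[nhds p] fun q ↦ -w := by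
    filter_upwards [hG.isOpen.mem_nhds hp] with q hq using hJ.sq q hq w
  have h2 := congrArg (fun L : E →L[ℝ] E ↦ L v) (h1.fderiv.symm.trans h3.fderiv_eq)
  simp at h2
  simp only [covEnd_apply, hJ.sq p hp, map_add, map_sub, map_neg]
  rw [eq_neg_of_add_eq_zero_right h2]
  abel

/-- The skewness of `∇J` holds near `p`, so it can be differentiated once more. -/
theorem inner_covEnd₂ (hG : IsMetricOn G U) (hJ : IsHermitianOn G J U) {p : E} (hp : p ∈ U)
    (u v w z : E) : G p (covEnd₂ G J p u v w) z = -G p w (covEnd₂ G J p u v z) := by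
  have hA (x : E) : HasFDerivAt (fun q ↦ covEnd G J q v x)
      ((fderiv ℝ (covEnd G J) p).flip v |>.flip x) p := by
    have := ((differentiableAt_covEnd hG hJ hp).hasFDerivAt.clm_apply
      (hasFDerivAt_const (𝕜 := ℝ) v p)).clm_apply (hasFDerivAt_const (𝕜 := ℝ) x p)
    refine this.congr_fderiv ?_
    ext t
    simp
  have h1 := hG.fderiv_inner hp (hA w).differentiableAt (differentiableAt_const z) u
  have h2 := hG.fderiv_inner hp (differentiableAt_const w) (hA z).differentiableAt u
  have h3 : (fun q ↦ G q (covEnd G J q v w) z) =ᶠ[nhds p] fun q ↦ -G q w (covEnd G J q v z) := by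
    filter_upwards [hG.isOpen.mem_nhds hp] with q hq using inner_covEnd hG hJ hq v w z
  rw [h3.fderiv_eq, fderiv_fun_neg, neg_apply, h2, (hA w).fderiv, (hA z).fderiv] at h1
  simp [hG.fderiv_eq hp] at h1
  simp only [covEnd₂, map_add, map_sub, add_apply, sub_apply]
  rw [inner_covEnd hG hJ hp (christoffel G p u v) w z,
    inner_covEnd hG hJ hp v (christoffel G p u w) z]
  have h4 := inner_covEnd hG hJ hp v w (christoffel G p u z)
  linarith

/-- This is the second derivative of `J² = -1`. The two products of first derivatives are the source
of all quadratic terms in the formula for `s - s*`. -/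
theorem covEnd₂_anti (hG : IsMetricOn G U) (hJ : IsHermitianOn G J U) {p : E} (hp : p ∈ U)
    (u v w : E) : covEnd₂ G J p u v (J p w) =
      -J p (covEnd₂ G J p u v w) - covEnd G J p u (covEnd G J p v w)
        - covEnd G J p v (covEnd G J p u w) := by
  have hJ' := (hJ.differentiableAt hp).hasFDerivAt
  have hA := ((differentiableAt_covEnd hG hJ hp).hasFDerivAt.clm_apply
      (hasFDerivAt_const (𝕜 := ℝ) v p))
  have hw := hasFDerivAt_const (𝕜 := ℝ) w p
  have h1 := hA.clm_apply (hJ'.clm_apply hw)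
  have h2 := (hJ'.clm_apply (hA.clm_apply hw)).neg
  have h3 : (fun q ↦ covEnd G J q v (J q w)) =ᶠ[nhds p] -fun q ↦ J q (covEnd G J q v w) := by
    filter_upwards [hG.isOpen.mem_nhds hp] with q hq using covEnd_anti hG hJ hq v w
  have h4 := congrArg (fun L : E →L[ℝ] E ↦ L u) (h1.fderiv.symm.trans (h3.fderiv_eq.trans h2.fderiv))
  simp at h4
  have h5 : fderiv ℝ J p u w = covEnd G J p u w - christoffel G p u (J p w)
    + J p (christoffel G p u w) := by rw [covEnd_apply]; abel
  have h6 : fderiv ℝ J p u (covEnd G J p v w) = covEnd G J p u (covEnd G J p v w)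
    - christoffel G p u (J p (covEnd G J p v w))
    + J p (christoffel G p u (covEnd G J p v w)) := by
      rw [covEnd_apply (v := u)]; abel
  rw [h5, h6] at h4
  simp only [map_add, map_sub, covEnd_anti hG hJ hp] at h4
  simp only [covEnd₂, map_add, map_sub, covEnd_anti hG hJ hp, map_neg]
  rw [← sub_eq_zero] at h4 ⊢
  rw [← h4]
  abel

end IsHermitianOn

end Coord

end AlmostHermitianGeometry

/-! ### Contraction of `∇J` and the formula for `s - s*` in coordinates -/

namespace AlmostHermitianGeometry

namespace Coord

variable {E : Type*} [NormedAddCommGroup E] [NormedSpace ℝ E] [FiniteDimensional ℝ E]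
  {G : E → E →L[ℝ] E →L[ℝ] ℝ} {J : E → E →L[ℝ] E} {U : Set E}

section Contraction

variable {ι : Type*} {p : E} {e : ι → E}

/-- The frame which is dual, with respect to `G`, to the constant coframe which at `p` is dual
to `e`. -/
def dualFrame (G : E → E →L[ℝ] E →L[ℝ] ℝ) (p : E) (e : ι → E) (a : ι) (q : E) : E :=
  (G q).inverse (G p (e a))

theorem inner_dualFrame (hG : IsMetricOn G U) {q : E} (hq : q ∈ U) (a : ι) (z : E) :
    G q (dualFrame G p e a q) z = G p (e a) z := by
  rw [dualFrame, hG.apply_inverse hq]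

theorem dualFrame_self (hG : IsMetricOn G U) (hp : p ∈ U) (a : ι) :
    dualFrame G p e a p = e a :=
  (hG.isInvertible hp).inverse_apply_self _

theorem contDiffAt_dualFrame (hG : IsMetricOn G U) {q : E} (hq : q ∈ U) (a : ι) :
    ContDiffAt ℝ ∞ (dualFrame G p e a) q :=
  (hG.contDiffAt_inverse hq).clm_apply contDiffAt_const

/-- The pairing of the dual frame with a constant vector is constant, so its derivative vanishes. -/
theorem inner_fderiv_dualFrame (hG : IsMetricOn G U) (hp : p ∈ U) (a : ι) (u z : E) :
    G p (fderiv ℝ (dualFrame G p e a) p u) z = -fderiv ℝ G p u (e a) z := by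
  have h1 := hG.fderiv_inner hp ((contDiffAt_dualFrame (e := e) (p := p) hG hp a).differentiableAt
    (by simp)) (differentiableAt_const z) u
  have h3 : (fun q ↦ G q (dualFrame G p e a q) z) =ᶠ[nhds p] fun q ↦ G p (e a) z := by
    filter_upwards [hG.isOpen.mem_nhds hp] with q hq using inner_dualFrame hG hq a z
  rw [h3.fderiv_eq, dualFrame_self hG hp] at h1
  simp at h1
  linarith

variable [Fintype ι] [DecidableEq ι]

/-- The contraction of a bilinear map with respect to `G`, in terms of the dual frame. -/
theorem sum_orthonormal_eq_sum_dualFrame {F : Type*} [AddCommGroup F] [Module ℝ F]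
    [TopologicalSpace F] [IsTopologicalAddGroup F] [ContinuousConstSMul ℝ F]
    (hG : IsMetricOn G U) (he : IsOrthonormalBasis (G p) e) {q : E} (hq : q ∈ U) (hp : p ∈ U)
    {κ : Type*} [Fintype κ] [DecidableEq κ] {f : κ → E} (hf : IsOrthonormalBasis (G q) f)
    (B : E →L[ℝ] E →L[ℝ] F) :
    ∑ i, B (f i) (f i) = ∑ a, B (dualFrame G p e a q) (e a) := by
  have h1 (i : κ) : B (f i) (f i) = ∑ a, G p (f i) (e a) • B (f i) (e a) := by
    conv_lhs => rw [← he.sum_eq (f i), map_sum]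
    simp [he.sum_eq]
  have h2 (a : ι) : B (dualFrame G p e a q) (e a) = ∑ i, G p (f i) (e a) • B (f i) (e a) := by
    conv_lhs => rw [← hf.sum_eq (dualFrame G p e a q)]
    simp [inner_dualFrame hG hq, hG.symm p hp (e a)]
  simp only [h1, h2]
  exact Finset.sum_comm

variable {V : E → E}

/-- The orthonormal bases in `hV` are chosen point by point and may jump. Rewriting the trace with
the smooth dual frame removes the dependence on that choice. -/
theorem contDiffAt_contraction (hG : IsMetricOn G U) (hJ : IsHermitianOn G J U) (hp : p ∈ U)
    (he : IsOrthonormalBasis (G p) e)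
    (hV : ∀ q ∈ U, ∃ f : ι → E, IsOrthonormalBasis (G q) f ∧
      V q = ∑ i, covEnd G J q (f i) (f i)) :
    ContDiffAt ℝ ∞ V p := by
  have h : V =ᶠ[nhds p] fun q ↦ ∑ a, covEnd G J q (dualFrame G p e a q) (e a) := by
    filter_upwards [hG.isOpen.mem_nhds hp] with q hq
    obtain ⟨f, hf, hVq⟩ := hV q hq
    rw [hVq, sum_orthonormal_eq_sum_dualFrame hG he hq hp hf]
  refine ContDiffAt.congr_of_eventuallyEq (ContDiffAt.sum fun a _ ↦ ?_) h
  exact ((IsHermitianOn.contDiffAt_covEnd hG hJ hp).clm_apply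
    (contDiffAt_dualFrame hG hp a)).clm_apply contDiffAt_const

/-- Contraction commutes with covariant differentiation. -/
theorem cov_contraction (hG : IsMetricOn G U) (hJ : IsHermitianOn G J U) (hp : p ∈ U)
    (he : IsOrthonormalBasis (G p) e)
    (hV : ∀ q ∈ U, ∃ f : ι → E, IsOrthonormalBasis (G q) f ∧
      V q = ∑ i, covEnd G J q (f i) (f i)) (u : E) :
    cov G V p u = ∑ i, covEnd₂ G J p u (e i) (e i) := by
  have h : V =ᶠ[nhds p] fun q ↦ ∑ a, covEnd G J q (dualFrame G p e a q) (e a) := by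
    filter_upwards [hG.isOpen.mem_nhds hp] with q hq
    obtain ⟨f, hf, hVq⟩ := hV q hq
    rw [hVq, sum_orthonormal_eq_sum_dualFrame hG he hq hp hf]
  have hd (a : ι) := (((IsHermitianOn.differentiableAt_covEnd hG hJ hp).hasFDerivAt.clm_apply
    ((contDiffAt_dualFrame (e := e) (p := p) hG hp a).differentiableAt
      (by simp)).hasFDerivAt).clm_apply (hasFDerivAt_const (𝕜 := ℝ) (e a) p))
  have hD := HasFDerivAt.fun_sum (u := Finset.univ) fun a _ ↦ hd a
  -- By metric compatibility the dual frame moves by minus the Christoffel endomorphism and minus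
  -- its adjoint.
  have hdual (a : ι) : fderiv ℝ (dualFrame G p e a) p u = -christoffel G p u (e a)
      - ∑ b, G p (christoffel G p u (e b)) (e a) • e b := by
    rw [← he.sum_eq (fderiv ℝ (dualFrame G p e a) p u)]
    simp only [inner_fderiv_dualFrame hG hp, hG.fderiv_eq hp, neg_add, add_smul,
      Finset.sum_add_distrib, hG.symm p hp (e a)]
    simp only [neg_smul, Finset.sum_neg_distrib, he.sum_eq]
    abel
  -- Inside the trace the adjoint can be shifted to the other slot, where it is the missing
  -- Christoffel correction of `covEnd₂`.
  have hsum : ∑ a, covEnd G J p (∑ b, G p (christoffel G p u (e b)) (e a) • e b) (e a)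
      = ∑ b, covEnd G J p (e b) (christoffel G p u (e b)) := by
    have h1 (b : ι) : covEnd G J p (e b) (christoffel G p u (e b)) =
        ∑ a, G p (christoffel G p u (e b)) (e a) • covEnd G J p (e b) (e a) := by
      conv_lhs => rw [← he.sum_eq (christoffel G p u (e b)), map_sum]
      simp
    simp only [h1]
    rw [Finset.sum_comm]
    simp
  have hDu : fderiv ℝ V p u = ∑ a, (fderiv ℝ (covEnd G J) p u (e a) (e a)
      + covEnd G J p (fderiv ℝ (dualFrame G p e a) p u) (e a)) := by
    rw [h.fderiv_eq, hD.fderiv]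
    simp [dualFrame_self hG hp, add_comm]
  rw [cov, hDu, h.eq_of_nhds]
  simp only [hdual, dualFrame_self hG hp, covEnd₂, map_sub, map_neg, sub_apply, neg_apply,
    Finset.sum_add_distrib, Finset.sum_sub_distrib, Finset.sum_neg_distrib, hsum,
    map_sum (christoffel G p u)]
  abel

/-- The divergence of the vector field `J V`, where `V` is the contraction of `∇J`, computes the
difference of the scalar curvature and the `*`-scalar curvature up to terms quadratic in `∇J`. -/
theorem scal_sub_scalStar (hG : IsMetricOn G U) (hJ : IsHermitianOn G J U) (hp : p ∈ U)
    (he : IsOrthonormalBasis (G p) e)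
    (hV : ∀ q ∈ U, ∃ f : ι → E, IsOrthonormalBasis (G q) f ∧
      V q = ∑ i, covEnd G J q (f i) (f i)) :
    ∑ j, ∑ i, G p (curv G p (e j) (e i) (e i)) (e j)
      - ∑ j, ∑ i, G p (curv G p (e j) (e i) (J p (e i))) (J p (e j)) =
    2 * ∑ i, G p (cov G (fun q ↦ J q (V q)) p (e i)) (e i) + G p (V p) (V p)
      - ∑ i, ∑ j, G p (covEnd G J p (e i) (e j)) (covEnd G J p (e j) (e i)) := by
  have hVp : ∑ i, covEnd G J p (e i) (e i) = V p := by
    obtain ⟨f, hf, hVq⟩ := hV p hp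
    rw [hVq, sum_orthonormal_eq_sum_dualFrame hG he hp hp hf]
    simp [dualFrame_self hG hp]
  have hN := cov_contraction hG hJ hp he hV
  have hdV := (contDiffAt_contraction hG hJ hp he hV).differentiableAt (by simp)
  -- Product rule for `J V`; by skewness the term where `J` is differentiated contracts to `-|V|²`.
  have hdiv : ∑ i, G p (cov G (fun q ↦ J q (V q)) p (e i)) (e i) =
      -G p (V p) (V p) - ∑ i, G p (cov G V p (e i)) (J p (e i)) := by
    have h1 (i : ι) : cov G (fun q ↦ J q (V q)) p (e i) =
        covEnd G J p (e i) (V p) + J p (cov G V p (e i)) := by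
      rw [cov, ((hJ.differentiableAt hp).hasFDerivAt.clm_apply hdV.hasFDerivAt).fderiv]
      simp [covEnd_apply, cov]
      abel
    simp only [h1, map_add, add_apply, Finset.sum_add_distrib, IsHermitianOn.inner_covEnd hG hJ hp,
      hJ.inner_left hp, Finset.sum_neg_distrib, ← map_sum, hVp]
    ring
  -- Applying the isometry `J` to both arguments of the first term exposes the commutator of the
  -- curvature with `J`, to which the Ricci identity applies.
  have h1 (i j : ι) : G p (curv G p (e j) (e i) (e i)) (e j)
      - G p (curv G p (e j) (e i) (J p (e i))) (J p (e j)) =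
      -G p (covEnd₂ G J p (e j) (e i) (e i)) (J p (e j))
        + G p (covEnd₂ G J p (e i) (e j) (e i)) (J p (e j)) := by
    have := hJ.covEnd₂_sub hG hp (e j) (e i) (e i)
    rw [← hJ.orthogonal p hp (curv G p (e j) (e i) (e i)) (e j), ← sub_apply, ← map_sub,
      ← neg_sub (curv G p (e j) (e i) (J p (e i))), ← this]
    simp
    ring
  -- The repeated index must sit in the last two slots of `∇²J`. Skewness moves the operator onto `J
  -- e_j`, and `covEnd₂_anti` then pulls `J` out, leaving products of first derivatives.
  have h2 (i j : ι) : G p (covEnd₂ G J p (e i) (e j) (e i)) (J p (e j)) =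
      -G p (covEnd₂ G J p (e i) (e j) (e j)) (J p (e i))
        - G p (covEnd G J p (e i) (e i)) (covEnd G J p (e j) (e j))
        - G p (covEnd G J p (e i) (e j)) (covEnd G J p (e j) (e i)) := by
    rw [hJ.inner_covEnd₂ hG hp, hJ.covEnd₂_anti hG hp]
    simp only [map_sub, map_neg]
    have h3 := hJ.inner_left hp (e i) (covEnd₂ G J p (e i) (e j) (e j))
    rw [hG.symm p hp (J p (e i))] at h3
    have h4 := hJ.inner_covEnd hG hp (e i) (e i) (covEnd G J p (e j) (e j))
    have h5 := hJ.inner_covEnd hG hp (e j) (e i) (covEnd G J p (e i) (e j))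
    rw [hG.symm p hp (covEnd G J p (e j) (e i))] at h5
    linarith
  have h3 : ∑ j, ∑ i, G p (covEnd₂ G J p (e j) (e i) (e i)) (J p (e j)) =
      ∑ i, G p (cov G V p (e i)) (J p (e i)) := by
    simp [hN]
  have h4 : ∑ j, ∑ i, G p (covEnd₂ G J p (e i) (e j) (e j)) (J p (e i)) =
      ∑ i, G p (cov G V p (e i)) (J p (e i)) := by
    rw [Finset.sum_comm]
    simp [hN]
  have h5 : ∑ j, ∑ i, G p (covEnd G J p (e i) (e i)) (covEnd G J p (e j) (e j)) =
      G p (V p) (V p) := by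
    simp [← hVp]
  have h6 : ∑ j, ∑ i, G p (covEnd G J p (e i) (e j)) (covEnd G J p (e j) (e i)) =
      ∑ i, ∑ j, G p (covEnd G J p (e i) (e j)) (covEnd G J p (e j) (e i)) :=
    Finset.sum_comm
  rw [hdiv, ← Finset.sum_sub_distrib]
  simp only [← Finset.sum_sub_distrib, h1, h2]
  simp only [Finset.sum_add_distrib, Finset.sum_sub_distrib, Finset.sum_neg_distrib, h3, h4, h5, h6]
  ring

end Contraction

end Coord

end AlmostHermitianGeometry

namespace AlmostHermitianGeometry

variable {E : Type*} [NormedAddCommGroup E] [NormedSpace ℝ E] [FiniteDimensional ℝ E]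
  {H : Type*} [TopologicalSpace H] {I : ModelWithCorners ℝ E H}
  {M : Type*} [TopologicalSpace M] [ChartedSpace H M] [IsManifold I ∞ M]

/-! ### Tensor fields read in a chart -/

/-- In finite dimension a linear map is determined by finitely many columns, so smoothness can be
checked on each vector. -/
theorem contDiffAt_of_forall_clm_apply {D F : Type*} [NormedAddCommGroup D] [NormedSpace ℝ D]
    [NormedAddCommGroup F] [NormedSpace ℝ F] {f : D → E →L[ℝ] F} {x : D}
    (h : ∀ v, ContDiffAt ℝ ∞ (fun y ↦ f y v) x) : ContDiffAt ℝ ∞ f x := by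
  let e₁ := ContinuousLinearEquiv.ofFinrankEq
    (Module.finrank_fin_fun ℝ (n := Module.finrank ℝ E)).symm
  let e₂ := (e₁.arrowCongr (1 : F ≃L[ℝ] F)).trans (ContinuousLinearEquiv.piRing (Fin _))
  rw [← Function.id_comp f, ← e₂.symm_comp_self]
  exact e₂.symm.contDiff.contDiffAt.comp x (contDiffAt_pi.2 fun i ↦ h _)

section Chart

/-- The coordinate frame of the chart at `x₀`, as a linear isomorphism from the model space to the
tangent space at the point with coordinates `p`. -/
def chartFrame (I : ModelWithCorners ℝ E H) {M : Type*} [TopologicalSpace M]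
    [ChartedSpace H M] [IsManifold I ∞ M] (x₀ : M) (p : E) :
    E →L[ℝ] TangentSpace I ((extChartAt I x₀).symm p) :=
  (trivializationAt E (TangentSpace I) x₀).symmL ℝ ((extChartAt I x₀).symm p)

/-- The components of a tangent vector in the coordinate frame of the chart at `x₀`. -/
def chartCoframe (I : ModelWithCorners ℝ E H) {M : Type*} [TopologicalSpace M]
    [ChartedSpace H M] [IsManifold I ∞ M] (x₀ : M) (p : E) :
    TangentSpace I ((extChartAt I x₀).symm p) →L[ℝ] E :=
  (trivializationAt E (TangentSpace I) x₀).continuousLinearMapAt ℝ ((extChartAt I x₀).symm p)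

/-- The vector field `X` in the chart at `x₀`. -/
def chartField (x₀ : M) (X : Π x : M, TangentSpace I x) (p : E) : E :=
  chartCoframe I x₀ p (X ((extChartAt I x₀).symm p))

/-- The metric `g` in the chart at `x₀`. -/
def chartMetric (g : SmoothMetric I M) (x₀ : M) (p : E) : E →L[ℝ] E →L[ℝ] ℝ :=
  (ContinuousLinearMap.precomp ℝ (chartFrame I x₀ p)) ∘L
    (g.inner ((extChartAt I x₀).symm p) ∘L chartFrame I x₀ p)

/-- The endomorphism field `J` in the chart at `x₀`. -/
def chartEnd (J : Π x : M, TangentSpace I x →L[ℝ] TangentSpace I x) (x₀ : M) (p : E) : E →L[ℝ] E :=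
  chartCoframe I x₀ p ∘L J ((extChartAt I x₀).symm p) ∘L chartFrame I x₀ p

theorem chartMetric_apply (g : SmoothMetric I M) (x₀ : M) (p v w : E) :
    chartMetric g x₀ p v w =
      g.inner ((extChartAt I x₀).symm p) (chartFrame I x₀ p v) (chartFrame I x₀ p w) := rfl

variable {x₀ : M} {p : E}

theorem mem_baseSet_of_mem_target (hp : p ∈ (extChartAt I x₀).target) :
    (extChartAt I x₀).symm p ∈ (trivializationAt E (TangentSpace I) x₀).baseSet := by
  have := (extChartAt I x₀).map_target hp
  rwa [extChartAt_source] at this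

theorem chartFrame_chartCoframe (hp : p ∈ (extChartAt I x₀).target)
    (v : TangentSpace I ((extChartAt I x₀).symm p)) :
    chartFrame I x₀ p (chartCoframe I x₀ p v) = v :=
  Trivialization.symmL_continuousLinearMapAt _ (mem_baseSet_of_mem_target hp) v

theorem chartCoframe_chartFrame (hp : p ∈ (extChartAt I x₀).target) (v : E) :
    chartCoframe I x₀ p (chartFrame I x₀ p v) = v :=
  Trivialization.continuousLinearMapAt_symmL _ (mem_baseSet_of_mem_target hp) v

theorem chartFrame_chartField (hp : p ∈ (extChartAt I x₀).target)
    (X : Π x : M, TangentSpace I x) :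
    chartFrame I x₀ p (chartField x₀ X p) = X ((extChartAt I x₀).symm p) :=
  chartFrame_chartCoframe hp _

theorem chartMetric_chartField (g : SmoothMetric I M) (hp : p ∈ (extChartAt I x₀).target)
    (X Y : Π x : M, TangentSpace I x) :
    chartMetric g x₀ p (chartField x₀ X p) (chartField x₀ Y p) =
      g.inner _ (X ((extChartAt I x₀).symm p)) (Y ((extChartAt I x₀).symm p)) := by
  rw [chartMetric_apply, chartFrame_chartField hp, chartFrame_chartField hp]

theorem chartFrame_chartEnd (J : Π x : M, TangentSpace I x →L[ℝ] TangentSpace I x)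
    (hp : p ∈ (extChartAt I x₀).target) (v : E) :
    chartFrame I x₀ p (chartEnd J x₀ p v) = J _ (chartFrame I x₀ p v) :=
  chartFrame_chartCoframe hp _

theorem chartField_end (J : Π x : M, TangentSpace I x →L[ℝ] TangentSpace I x)
    (hp : p ∈ (extChartAt I x₀).target) (X : Π x : M, TangentSpace I x) :
    chartField x₀ (fun y ↦ J y (X y)) p = chartEnd J x₀ p (chartField x₀ X p) := by
  simp only [chartEnd, chartField, ContinuousLinearMap.comp_apply, chartFrame_chartCoframe hp]

section Boundaryless

variable [I.Boundaryless]

theorem contMDiffAt_extChartAt_symm_of_mem (hp : p ∈ (extChartAt I x₀).target) :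
    ContMDiffAt 𝓘(ℝ, E) I ∞ (extChartAt I x₀).symm p :=
  (contMDiffOn_extChartAt_symm x₀ p hp).contMDiffAt
    ((isOpen_extChartAt_target x₀).mem_nhds hp)

/-- Sections along the inverse chart cover coordinate frames as well as restrictions of global
fields, so one criterion serves for fields, metrics and endomorphisms. -/
theorem contMDiffAt_section_along_chart_iff (hp : p ∈ (extChartAt I x₀).target)
    {s : Π q : E, TangentSpace I ((extChartAt I x₀).symm q)} :
    ContMDiffAt 𝓘(ℝ, E) I.tangent ∞
      (fun q ↦ (TotalSpace.mk' E ((extChartAt I x₀).symm q) (s q) : TangentBundle I M)) p ↔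
      ContDiffAt ℝ ∞ (fun q ↦ chartCoframe I x₀ q (s q)) p := by
  have he := mem_baseSet_of_mem_target hp
  rw [(trivializationAt E (TangentSpace I) x₀).contMDiffAt_iff
    ((trivializationAt E (TangentSpace I) x₀).mem_source.2 he), ← contMDiffAt_iff_contDiffAt,
    and_iff_right (contMDiffAt_extChartAt_symm_of_mem hp)]
  apply Filter.EventuallyEq.contMDiffAt_iff
  filter_upwards [(isOpen_extChartAt_target (I := I) x₀).mem_nhds hp] with q hq
  exact (Trivialization.continuousLinearMapAt_apply_of_mem ℝ _ (mem_baseSet_of_mem_target hq) _).symm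

theorem contMDiffAt_chartFrame (hp : p ∈ (extChartAt I x₀).target) (v : E) :
    ContMDiffAt 𝓘(ℝ, E) I.tangent ∞ (fun q ↦ (TotalSpace.mk' E ((extChartAt I x₀).symm q)
      (chartFrame I x₀ q v) : TangentBundle I M)) p := by
  rw [contMDiffAt_section_along_chart_iff hp]
  refine contDiffAt_const (c := v) |>.congr_of_eventuallyEq ?_
  filter_upwards [(isOpen_extChartAt_target (I := I) x₀).mem_nhds hp] with q hq
  exact chartCoframe_chartFrame hq v

theorem contDiffAt_chartField (hp : p ∈ (extChartAt I x₀).target) {X : Π x : M, TangentSpace I x}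
    (hX : ContMDiffAt I I.tangent ∞
      (fun x ↦ (TotalSpace.mk' E x (X x) : TangentBundle I M)) ((extChartAt I x₀).symm p)) :
    ContDiffAt ℝ ∞ (chartField x₀ X) p :=
  (contMDiffAt_section_along_chart_iff hp).1 (hX.comp p (contMDiffAt_extChartAt_symm_of_mem hp))

theorem contMDiffAt_of_contDiffAt_chartField (hp : p ∈ (extChartAt I x₀).target)
    {X : Π x : M, TangentSpace I x} (hX : ContDiffAt ℝ ∞ (chartField x₀ X) p) :
    ContMDiffAt I I.tangent ∞
      (fun x ↦ (TotalSpace.mk' E x (X x) : TangentBundle I M)) ((extChartAt I x₀).symm p) := by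
  have hs := (extChartAt I x₀).map_target hp
  have h1 := (contMDiffAt_section_along_chart_iff (s := fun q ↦ X _) hp).2 hX
  have h2 : ContMDiffAt I 𝓘(ℝ, E) ∞ (extChartAt I x₀) ((extChartAt I x₀).symm p) := by
    rw [extChartAt_source] at hs
    exact contMDiffAt_extChartAt' hs
  have h3 := ContMDiffAt.comp_of_eq (x := (extChartAt I x₀).symm p) h1 h2
    ((extChartAt I x₀).right_inv hp)
  refine h3.congr_of_eventuallyEq ?_
  filter_upwards [(isOpen_extChartAt_source (I := I) x₀).mem_nhds hs] with y hy
  simp only [Function.comp]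
  rw [(extChartAt I x₀).left_inv hy]

theorem differentiableAt_chartField (hp : p ∈ (extChartAt I x₀).target)
    {X : Π x : M, TangentSpace I x}
    (hX : MDifferentiableAt I I.tangent
      (fun x ↦ (TotalSpace.mk' E x (X x) : TangentBundle I M)) ((extChartAt I x₀).symm p)) :
    DifferentiableAt ℝ (chartField x₀ X) p := by
  have he := mem_baseSet_of_mem_target hp
  have h1 := ((trivializationAt E (TangentSpace I) x₀).mdifferentiableAt_section_iff I X he).1 hX
  have h2 := h1.comp p
    ((contMDiffAt_extChartAt_symm_of_mem hp).mdifferentiableAt (by simp))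
  refine h2.differentiableAt.congr_of_eventuallyEq ?_
  filter_upwards [(isOpen_extChartAt_target (I := I) x₀).mem_nhds hp] with q hq
  exact Trivialization.continuousLinearMapAt_apply_of_mem ℝ _ (mem_baseSet_of_mem_target hq) _

theorem contDiffAt_chartMetric (g : SmoothMetric I M) (hp : p ∈ (extChartAt I x₀).target) :
    ContDiffAt ℝ ∞ (chartMetric g x₀) p := by
  refine contDiffAt_of_forall_clm_apply ?_
  intro v
  refine contDiffAt_of_forall_clm_apply ?_
  intro w
  have h1 : ContMDiffAt 𝓘(ℝ, E) (I.prod 𝓘(ℝ)) ∞ (fun q ↦ TotalSpace.mk' ℝ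
      (E := Bundle.Trivial M ℝ) ((extChartAt I x₀).symm q)
      (g.inner ((extChartAt I x₀).symm q) (chartFrame I x₀ q v) (chartFrame I x₀ q w))) p := by
    apply ContMDiffAt.clm_bundle_apply₂ (F₁ := E) (F₂ := E)
    · exact (g.contMDiff _).comp p (contMDiffAt_extChartAt_symm_of_mem hp)
    · exact contMDiffAt_chartFrame hp v
    · exact contMDiffAt_chartFrame hp w
  rw [contMDiffAt_totalSpace] at h1
  exact contMDiffAt_iff_contDiffAt.1 h1.2

theorem contDiffAt_chartEnd {J : Π x : M, TangentSpace I x →L[ℝ] TangentSpace I x}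
    (hJ : ContMDiff I (I.prod 𝓘(ℝ, E →L[ℝ] E)) ∞
      (fun x ↦ (TotalSpace.mk' (E →L[ℝ] E) x (J x) :
        TotalSpace (E →L[ℝ] E) (fun x : M ↦ TangentSpace I x →L[ℝ] TangentSpace I x))))
    (hp : p ∈ (extChartAt I x₀).target) :
    ContDiffAt ℝ ∞ (chartEnd J x₀) p := by
  refine contDiffAt_of_forall_clm_apply ?_
  intro v
  refine (contMDiffAt_section_along_chart_iff
    (s := fun q ↦ J ((extChartAt I x₀).symm q) (chartFrame I x₀ q v)) hp).1 ?_
  apply ContMDiffAt.clm_bundle_apply (F₁ := E)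
  · exact (hJ _).comp p (contMDiffAt_extChartAt_symm_of_mem hp)
  · exact contMDiffAt_chartFrame hp v

theorem isMetricOn_chartMetric (g : SmoothMetric I M) (x₀ : M) :
    Coord.IsMetricOn (chartMetric g x₀) (extChartAt I x₀).target where
  isOpen := isOpen_extChartAt_target x₀
  contDiffAt _ hp := contDiffAt_chartMetric g hp
  symm p _ v w := g.symm _ _ _
  pos p hp v hv := by
    refine g.pos _ _ fun h ↦ hv ?_
    exact (chartCoframe_chartFrame hp v).symm.trans ((congrArg _ h).trans (map_zero _))

theorem isHermitianOn_chartEnd {g : SmoothMetric I M} (S : HermitianStructure g) (x₀ : M) :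
    Coord.IsHermitianOn (chartMetric g x₀) (chartEnd S.J x₀) (extChartAt I x₀).target where
  contDiffAt _ hp := contDiffAt_chartEnd S.smooth hp
  sq p hp v := by
    calc chartEnd S.J x₀ p (chartEnd S.J x₀ p v)
        = chartCoframe I x₀ p (S.J _ (chartFrame I x₀ p (chartEnd S.J x₀ p v))) := rfl
      _ = -v := by
        rw [chartFrame_chartEnd _ hp, S.sq, map_neg, chartCoframe_chartFrame hp]
  orthogonal p hp v w := by
    rw [chartMetric_apply, chartFrame_chartEnd _ hp, chartFrame_chartEnd _ hp, S.orthogonal]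
    rfl

/-- This ties the bundle trivialisation, in which tensors are read, to the differential of the
chart, in which derivatives of functions and Lie brackets are read. -/
theorem mfderiv_extChartAt_symm_eq (hp : p ∈ (extChartAt I x₀).target) :
    mfderiv 𝓘(ℝ, E) I (extChartAt I x₀).symm p = chartFrame I x₀ p := by
  have h := (extChartAt I x₀).map_target hp
  rw [extChartAt_source] at h
  have := TangentBundle.symmL_trivializationAt (I := I) h
  rw [I.range_eq_univ, mfderivWithin_univ, (extChartAt I x₀).right_inv hp] at this
  exact this.symm

theorem mvfderiv_chartFrame (hp : p ∈ (extChartAt I x₀).target) {F : Type*}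
    [NormedAddCommGroup F] [NormedSpace ℝ F] {f : M → F}
    (hf : MDifferentiableAt I 𝓘(ℝ, F) f ((extChartAt I x₀).symm p)) (v : E) :
    mvfderiv I f ((extChartAt I x₀).symm p) (chartFrame I x₀ p v) =
      fderiv ℝ (fun q ↦ f ((extChartAt I x₀).symm q)) p v := by
  rw [← mfderiv_extChartAt_symm_eq hp]
  have := mfderiv_comp_apply p hf
    ((contMDiffAt_extChartAt_symm_of_mem hp).mdifferentiableAt (by simp)) v
  rw [mfderiv_eq_fderiv] at this
  exact this.symm

theorem mpullback_extChartAt_symm (hp : p ∈ (extChartAt I x₀).target)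
    (X : Π x : M, TangentSpace I x) :
    mpullback 𝓘(ℝ, E) I (extChartAt I x₀).symm X p = chartField x₀ X p := by
  rw [mpullback_apply, mfderiv_extChartAt_symm_eq hp]
  have hinv : (chartFrame I x₀ p).IsInvertible :=
    ContinuousLinearMap.IsInvertible.of_inverse (g := chartCoframe I x₀ p)
      (ContinuousLinearMap.ext (chartFrame_chartCoframe hp))
      (ContinuousLinearMap.ext (chartCoframe_chartFrame hp))
  conv_lhs => rw [← chartFrame_chartField hp X]
  exact hinv.inverse_apply_self _

/-- Naturality of the Lie bracket under pullback by the inverse chart. -/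
theorem chartField_mlieBracket (hp : p ∈ (extChartAt I x₀).target)
    {X Y : Π x : M, TangentSpace I x}
    (hX : MDifferentiableAt I I.tangent
      (fun x ↦ (TotalSpace.mk' E x (X x) : TangentBundle I M)) ((extChartAt I x₀).symm p))
    (hY : MDifferentiableAt I I.tangent
      (fun x ↦ (TotalSpace.mk' E x (Y x) : TangentBundle I M)) ((extChartAt I x₀).symm p)) :
    chartField x₀ (mlieBracket I X Y) p =
      lieBracket ℝ (chartField x₀ X) (chartField x₀ Y) p := by
  have h2 : minSmoothness ℝ 2 ≤ ∞ := by simpa using ENat.LEInfty.out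
  have : IsManifold I (minSmoothness ℝ 2) M := .of_le (n := ∞) h2
  have h := mpullback_mlieBracket (n := ∞) hX hY (contMDiffAt_extChartAt_symm_of_mem hp)
    h2
  rw [mpullback_extChartAt_symm hp] at h
  rw [h, ← mlieBracketWithin_univ, mlieBracketWithin_eq_lieBracketWithin]
  refine (congrFun lieBracketWithin_univ p).trans ?_
  have hev (Z : Π x : M, TangentSpace I x) :
      mpullback 𝓘(ℝ, E) I (extChartAt I x₀).symm Z =ᶠ[nhds p] chartField x₀ Z := by
    filter_upwards [(isOpen_extChartAt_target (I := I) x₀).mem_nhds hp] with q hq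
    exact mpullback_extChartAt_symm hq Z
  exact (hev X).lieBracket_vectorField_eq (hev Y)

end Boundaryless

end Chart

end AlmostHermitianGeometry

/-! ### The Levi-Civita connection, curvature and `∇J` of the manifold, read in a chart -/

namespace AlmostHermitianGeometry

variable {E : Type*} [NormedAddCommGroup E] [NormedSpace ℝ E] [FiniteDimensional ℝ E]
  {H : Type*} [TopologicalSpace H] {I : ModelWithCorners ℝ E H}
  {M : Type*} [TopologicalSpace M] [ChartedSpace H M] [IsManifold I ∞ M]

theorem isOrthonormalBasis_onb (g : SmoothMetric I M) (x : M) :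
    IsOrthonormalBasis (g.inner x) (onb g x) where
  inner_eq := inner_onb g x
  sum_eq v := by
    let : RiemannianBundle (fun x : M ↦ TangentSpace I x) := ⟨g.toRiemannianMetric⟩
    have : FiniteDimensional ℝ (TangentSpace I x) := inferInstanceAs (FiniteDimensional ℝ E)
    have h := (stdOrthonormalBasis ℝ (TangentSpace I x)).sum_repr' v
    conv_rhs => rw [← h]
    refine Finset.sum_congr rfl fun i _ ↦ ?_
    congr 1
    exact g.symm x v _

theorem mdifferentiableAt_inner (g : SmoothMetric I M) {Y Z : Π x : M, TangentSpace I x} {x : M}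
    (hY : MDiffAt (T% Y) x) (hZ : MDiffAt (T% Z) x) :
    MDifferentiableAt I 𝓘(ℝ, ℝ) (fun y ↦ g.inner y (Y y) (Z y)) x := by
  have h1 : MDifferentiableAt I (I.prod 𝓘(ℝ)) (fun y ↦ TotalSpace.mk' ℝ
      (E := Bundle.Trivial M ℝ) y (g.inner y (Y y) (Z y))) x := by
    apply MDifferentiableAt.clm_bundle_apply₂ (F₁ := E) (F₂ := E)
    · exact (g.contMDiff x).mdifferentiableAt (by simp)
    · exact hY
    · exact hZ
  rw [mdifferentiableAt_totalSpace] at h1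
  exact h1.2

theorem eventually_mdifferentiableAt {X : Π x : M, TangentSpace I x} {x : M}
    (hX : CMDiffAt ∞ (T% X) x) : ∀ᶠ y in nhds x, MDiffAt (T% X) y :=
  -- Smoothness of finite order at a point spreads to a neighbourhood; for order `∞` the
  -- neighbourhoods could shrink, hence the drop to order `1`.
  ((contMDiffAt_iff_contMDiffAt_nhds (by simp)).1 (hX.of_le (m := 1) ENat.LEInfty.out)).mono
    fun _ hy ↦ hy.mdifferentiableAt one_ne_zero

variable [I.Boundaryless] {x₀ : M} {p : E} {g : SmoothMetric I M}
  {X Y Z : Π x : M, TangentSpace I x}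

theorem eventually_mdifferentiableAt_chart (hp : p ∈ (extChartAt I x₀).target)
    (hX : CMDiffAt ∞ (T% X) ((extChartAt I x₀).symm p)) :
    ∀ᶠ q in nhds p, MDiffAt (T% X) ((extChartAt I x₀).symm q) :=
  (contMDiffAt_extChartAt_symm_of_mem hp).continuousAt.eventually (eventually_mdifferentiableAt hX)

theorem derivInner_chart (hp : p ∈ (extChartAt I x₀).target)
    (hY : MDiffAt (T% Y) ((extChartAt I x₀).symm p))
    (hZ : MDiffAt (T% Z) ((extChartAt I x₀).symm p)) :
    derivInner g X Y Z ((extChartAt I x₀).symm p) =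
      fderiv ℝ (fun q ↦ chartMetric g x₀ q (chartField x₀ Y q) (chartField x₀ Z q)) p
        (chartField x₀ X p) := by
  rw [derivInner, ← chartFrame_chartField hp X, mvfderiv_chartFrame hp
    (mdifferentiableAt_inner g hY hZ)]
  congr 1
  apply Filter.EventuallyEq.fderiv_eq
  filter_upwards [(isOpen_extChartAt_target (I := I) x₀).mem_nhds hp] with q hq
  exact (chartMetric_chartField g hq Y Z).symm

/-- The Koszul formula in a chart. -/
theorem koszul_chart (hp : p ∈ (extChartAt I x₀).target)
    (hX : MDiffAt (T% X) ((extChartAt I x₀).symm p))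
    (hY : MDiffAt (T% Y) ((extChartAt I x₀).symm p))
    (hZ : MDiffAt (T% Z) ((extChartAt I x₀).symm p)) :
    koszul g X Y Z ((extChartAt I x₀).symm p) =
      chartMetric g x₀ p (Coord.cov (chartMetric g x₀) (chartField x₀ Y) p (chartField x₀ X p))
        (chartField x₀ Z p) := by
  rw [← (isMetricOn_chartMetric g x₀).koszul_eq hp (differentiableAt_chartField hp hX)
    (differentiableAt_chartField hp hY) (differentiableAt_chartField hp hZ), koszul,
    derivInner_chart hp hY hZ, derivInner_chart hp hZ hX, derivInner_chart hp hX hY,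
    ← chartField_mlieBracket hp hX hY, ← chartField_mlieBracket hp hX hZ,
    ← chartField_mlieBracket hp hY hZ]
  simp only [chartMetric_chartField g hp]

/-- The Koszul expression uses arbitrary extensions, but in coordinates it depends only on their
values at the point; expanding in the orthonormal basis then recovers the vector. -/
theorem nabla_chartFrame (hp : p ∈ (extChartAt I x₀).target)
    (hY : MDiffAt (T% Y) ((extChartAt I x₀).symm p)) (v : E) :
    nabla g Y ((extChartAt I x₀).symm p) (chartFrame I x₀ p v) =
      chartFrame I x₀ p (Coord.cov (chartMetric g x₀) (chartField x₀ Y) p v) := by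
  rw [nabla, ← (isOrthonormalBasis_onb g _).sum_eq
    (chartFrame I x₀ p (Coord.cov (chartMetric g x₀) (chartField x₀ Y) p v))]
  refine Finset.sum_congr rfl fun i _ ↦ ?_
  congr 1
  rw [koszul_chart hp (FiberBundle.mdifferentiableAt_extend ..) hY
    (FiberBundle.mdifferentiableAt_extend ..)]
  simp only [chartField, FiberBundle.extend_apply_self, chartCoframe_chartFrame hp]
  rw [chartMetric_apply, chartFrame_chartCoframe hp]

theorem nabla_eq_chartFrame (hp : p ∈ (extChartAt I x₀).target)
    (hY : MDiffAt (T% Y) ((extChartAt I x₀).symm p))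
    (v : TangentSpace I ((extChartAt I x₀).symm p)) :
    nabla g Y ((extChartAt I x₀).symm p) v =
      chartFrame I x₀ p (Coord.cov (chartMetric g x₀) (chartField x₀ Y) p
        (chartCoframe I x₀ p v)) := by
  rw [← nabla_chartFrame hp hY, chartFrame_chartCoframe hp]

theorem chartField_nablaField (hp : p ∈ (extChartAt I x₀).target)
    (hY : MDiffAt (T% Y) ((extChartAt I x₀).symm p)) :
    chartField x₀ (nablaField g X Y) p =
      Coord.cov (chartMetric g x₀) (chartField x₀ Y) p (chartField x₀ X p) := by
  rw [chartField, nablaField, nabla_eq_chartFrame hp hY, chartCoframe_chartFrame hp]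
  rfl

theorem chartField_nablaField_eventuallyEq (hp : p ∈ (extChartAt I x₀).target)
    (hY : CMDiffAt ∞ (T% Y) ((extChartAt I x₀).symm p)) :
    chartField x₀ (nablaField g X Y) =ᶠ[nhds p]
      fun q ↦ Coord.cov (chartMetric g x₀) (chartField x₀ Y) q (chartField x₀ X q) := by
  filter_upwards [(isOpen_extChartAt_target (I := I) x₀).mem_nhds hp,
    eventually_mdifferentiableAt_chart hp hY] with q hq hYq
  exact chartField_nablaField hq hYq

/-- The curvature differentiates a covariant derivative, so the inner one has to be a smooth field.
-/
theorem contMDiffAt_nablaField (hp : p ∈ (extChartAt I x₀).target)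
    (hX : CMDiffAt ∞ (T% X) ((extChartAt I x₀).symm p))
    (hY : CMDiffAt ∞ (T% Y) ((extChartAt I x₀).symm p)) :
    CMDiffAt ∞ (T% (nablaField g X Y)) ((extChartAt I x₀).symm p) := by
  apply contMDiffAt_of_contDiffAt_chartField hp
  refine ContDiffAt.congr_of_eventuallyEq ?_ (chartField_nablaField_eventuallyEq hp hY)
  have h1 := contDiffAt_chartField hp hX
  have h2 := contDiffAt_chartField hp hY
  have h3 := (isMetricOn_chartMetric g x₀).contDiffAt_christoffel hp
  exact ((h2.fderiv_right (m := ∞) (by simp)).clm_apply h1).add ((h3.clm_apply h1).clm_apply h2)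

theorem curvatureField_chart (hp : p ∈ (extChartAt I x₀).target)
    (hX : CMDiffAt ∞ (T% X) ((extChartAt I x₀).symm p))
    (hY : CMDiffAt ∞ (T% Y) ((extChartAt I x₀).symm p))
    (hZ : CMDiffAt ∞ (T% Z) ((extChartAt I x₀).symm p)) :
    curvatureField g X Y Z ((extChartAt I x₀).symm p) =
      chartFrame I x₀ p (Coord.curv (chartMetric g x₀) p (chartField x₀ X p) (chartField x₀ Y p)
        (chartField x₀ Z p)) := by
  have hmd {W : Π x : M, TangentSpace I x} (hW : CMDiffAt ∞ (T% W) ((extChartAt I x₀).symm p)) :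
      MDiffAt (T% W) ((extChartAt I x₀).symm p) := hW.mdifferentiableAt (by simp)
  rw [← (isMetricOn_chartMetric g x₀).curvature_eq hp (contDiffAt_chartField hp hX)
    (contDiffAt_chartField hp hY) (contDiffAt_chartField hp hZ),
    ← chartField_mlieBracket hp (hmd hX) (hmd hY), ← chartField_nablaField hp (hmd hZ)]
  have h (V W : Π x : M, TangentSpace I x) (hV : CMDiffAt ∞ (T% V) ((extChartAt I x₀).symm p)) :
      Coord.cov (chartMetric g x₀) (fun q ↦ Coord.cov (chartMetric g x₀) (chartField x₀ Z) q
        (chartField x₀ V q)) p (chartField x₀ W p) =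
      chartField x₀ (nablaField g W (nablaField g V Z)) p := by
    rw [chartField_nablaField hp (hmd (contMDiffAt_nablaField hp hV hZ))]
    exact (Coord.cov_congr _ (chartField_nablaField_eventuallyEq (g := g) (X := V) hp hZ) _).symm
  rw [h Y X hY, h X Y hX, map_sub, map_sub]
  simp only [chartFrame_chartField hp]
  rfl

theorem curvature_chartFrame (hp : p ∈ (extChartAt I x₀).target) (u v w : E) :
    curvature g ((extChartAt I x₀).symm p) (chartFrame I x₀ p u) (chartFrame I x₀ p v)
        (chartFrame I x₀ p w) =
      chartFrame I x₀ p (Coord.curv (chartMetric g x₀) p u v w) := by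
  rw [curvature, curvatureField_chart hp (FiberBundle.contMDiffAt_extend ..)
    (FiberBundle.contMDiffAt_extend ..) (FiberBundle.contMDiffAt_extend ..)]
  simp only [chartField, FiberBundle.extend_apply_self, chartCoframe_chartFrame hp]

/-- The derivative of the extension of `w` appears under `J` in both terms and cancels, which makes
the expression tensorial. -/
theorem nablaJ_chartFrame (hp : p ∈ (extChartAt I x₀).target)
    {J : Π x : M, TangentSpace I x →L[ℝ] TangentSpace I x}
    (hJ : ContMDiff I (I.prod 𝓘(ℝ, E →L[ℝ] E)) ∞
      (fun x ↦ (TotalSpace.mk' (E →L[ℝ] E) x (J x) :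
        TotalSpace (E →L[ℝ] E) (fun x : M ↦ TangentSpace I x →L[ℝ] TangentSpace I x))))
    (v w : E) :
    nablaJ g J ((extChartAt I x₀).symm p) (chartFrame I x₀ p v) (chartFrame I x₀ p w) =
      chartFrame I x₀ p (Coord.covEnd (chartMetric g x₀) (chartEnd J x₀) p v w) := by
  set W : Π x : M, TangentSpace I x := FiberBundle.extend E (chartFrame I x₀ p w) with hW
  have hWs : MDiffAt (T% W) ((extChartAt I x₀).symm p) := FiberBundle.mdifferentiableAt_extend ..
  have hJW : MDiffAt (T% (fun y ↦ J y (W y))) ((extChartAt I x₀).symm p) := by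
    apply MDifferentiableAt.clm_bundle_apply (F₁ := E)
    · exact (hJ _).mdifferentiableAt (by simp)
    · exact hWs
  have hWp : chartField x₀ W p = w := by
    simp only [chartField, hW, FiberBundle.extend_apply_self]
    exact chartCoframe_chartFrame hp w
  have hev : chartField x₀ (fun y ↦ J y (W y)) =ᶠ[nhds p]
      fun q ↦ chartEnd J x₀ q (chartField x₀ W q) := by
    filter_upwards [(isOpen_extChartAt_target (I := I) x₀).mem_nhds hp] with q hq
    exact chartField_end J hq W
  have hd := ((contDiffAt_chartEnd hJ hp).differentiableAt (by simp)).hasFDerivAt.clm_apply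
    (differentiableAt_chartField hp hWs).hasFDerivAt
  rw [nablaJ, nabla_chartFrame hp hJW, nabla_chartFrame hp hWs, ← chartFrame_chartEnd _ hp,
    ← map_sub]
  congr 1
  rw [Coord.cov_congr _ hev, Coord.cov, hd.fderiv, Coord.cov, Coord.covEnd_apply]
  simp only [add_apply, ContinuousLinearMap.comp_apply, ContinuousLinearMap.flip_apply, map_add,
    hWp]
  abel

end AlmostHermitianGeometry

namespace AlmostHermitianGeometry

/-! ### Hermitian linear algebra -/

namespace IsOrthonormalBasis

variable {V ι κ : Type*} [AddCommGroup V] [Module ℝ V] [TopologicalSpace V]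
  [Fintype ι] [DecidableEq ι] [Fintype κ] [DecidableEq κ]
  {b : V →L[ℝ] V →L[ℝ] ℝ} {e : ι → V} {f : κ → V}

theorem sum_mul (he : IsOrthonormalBasis b e) (x y : V) : ∑ i, b x (e i) * b y (e i) = b y x := by
  conv_rhs => rw [← he.sum_eq x]
  simp

theorem sum_inner_self (he : IsOrthonormalBasis b e) : ∑ i, b (e i) (e i) = Fintype.card ι := by
  simp [he.inner_eq]

/-- The trace of a bilinear map does not depend on the orthonormal basis. -/
theorem sum_eq_sum {F : Type*} [AddCommGroup F] [Module ℝ F] (hb : ∀ v w, b v w = b w v)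
    (he : IsOrthonormalBasis b e) (hf : IsOrthonormalBasis b f) (B : V →ₗ[ℝ] V →ₗ[ℝ] F) :
    ∑ i, B (f i) (f i) = ∑ a, B (e a) (e a) := by
  have h1 (i : κ) : B (f i) (f i) = ∑ a, b (f i) (e a) • B (f i) (e a) := by
    conv_lhs => rw [← he.sum_eq (f i), map_sum]
    simp [he.sum_eq]
  have h2 (a : ι) : B (e a) (e a) = ∑ i, b (f i) (e a) • B (f i) (e a) := by
    calc B (e a) (e a) = B (∑ i, b (e a) (f i) • f i) (e a) := by rw [hf.sum_eq]
      _ = _ := by simp [hb (e a)]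
  simp only [h1, h2]
  exact Finset.sum_comm

end IsOrthonormalBasis

/-- The algebraic properties of the covariant derivative `A` of an orthogonal almost complex
structure `J` at a point. -/
structure IsHermitianDeriv {V : Type*} [AddCommGroup V] [Module ℝ V] [TopologicalSpace V]
    (b : V →L[ℝ] V →L[ℝ] ℝ) (J : V →L[ℝ] V) (A : V →ₗ[ℝ] V →ₗ[ℝ] V) : Prop where
  symm : ∀ v w, b v w = b w v
  pos : ∀ v, v ≠ 0 → 0 < b v v
  sq : ∀ v, J (J v) = -v
  orthogonal : ∀ v w, b (J v) (J w) = b v w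
  skew : ∀ u v w, b (A u v) w = -b v (A u w)
  anti : ∀ u v, A u (J v) = -J (A u v)

namespace IsHermitianDeriv

variable {V ι : Type*} [AddCommGroup V] [Module ℝ V] [TopologicalSpace V]
  [Fintype ι] [DecidableEq ι]
  {b : V →L[ℝ] V →L[ℝ] ℝ} {J : V →L[ℝ] V} {A : V →ₗ[ℝ] V →ₗ[ℝ] V} {e : ι → V}

theorem inner_left (h : IsHermitianDeriv b J A) (v w : V) : b (J v) w = -b v (J w) := by
  have := h.orthogonal v (J w)
  rw [h.sq, map_neg] at this
  linarith

theorem eq_of_forall_inner (h : IsHermitianDeriv b J A) {v w : V} (hv : ∀ z, b v z = b w z) :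
    v = w := by
  by_contra hne
  have := h.pos (v - w) (sub_ne_zero.2 hne)
  rw [map_sub b, sub_apply, hv, sub_self] at this
  exact lt_irrefl _ this

theorem eq_zero_of_inner_self (h : IsHermitianDeriv b J A) {v : V} (hv : b v v = 0) : v = 0 := by
  by_contra hne
  exact (h.pos v hne).ne' hv

theorem inner_self_nonneg (h : IsHermitianDeriv b J A) (v : V) : 0 ≤ b v v := by
  by_cases hv : v = 0
  · simp [hv]
  · exact (h.pos v hv).le

/-- Comparing traces over `e` and over `J e` annihilates every trace that changes sign under `J`. -/
theorem isOrthonormalBasis_J (h : IsHermitianDeriv b J A) (he : IsOrthonormalBasis b e) :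
    IsOrthonormalBasis b (fun i ↦ J (e i)) where
  inner_eq i j := by rw [h.orthogonal, he.inner_eq]
  sum_eq v := by
    calc ∑ i, b v (J (e i)) • J (e i) = -J (∑ i, b (J v) (e i) • e i) := by
          simp [h.inner_left v]
      _ = v := by rw [he.sum_eq, h.sq, neg_neg]

theorem eq_zero_of_sum (h : IsHermitianDeriv b J A) (he : IsOrthonormalBasis b e)
    (hA : ∑ i, ∑ j, b (A (e i) (e j)) (A (e i) (e j)) = 0) (v w : V) : A v w = 0 := by
  have hA' (i j : ι) : A (e i) (e j) = 0 := by
    rw [Finset.sum_eq_zero_iff_of_nonneg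
      fun i _ ↦ Finset.sum_nonneg fun j _ ↦ h.inner_self_nonneg _] at hA
    have := hA i (Finset.mem_univ i)
    rw [Finset.sum_eq_zero_iff_of_nonneg fun j _ ↦ h.inner_self_nonneg _] at this
    exact h.eq_zero_of_inner_self (this j (Finset.mem_univ j))
  rw [← he.sum_eq v, ← he.sum_eq w]
  simp [hA']

/-! #### The class `𝒲₂` -/

/-- A cyclicity property passes from `T` to `T(·, ·, J ·)`. -/
theorem cyclic_J {T : V → V → V → ℝ} (hJ : ∀ u v w, T u (J v) w = T u v (J w))
    (hJJ : ∀ u v w, T u v (J (J w)) = -T u v w)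
    (hc : ∀ u v w, T u v w + T v w u + T w u v = 0) (u v w : V) :
    T u v (J w) + T v w (J u) + T w u (J v) = 0 := by
  -- The first three instances together contain each term of the goal twice; their leftovers, with
  -- `J` in the first slot, add up to zero by the fourth.
  have h1 := hc u v (J w)
  have h2 := hc w u (J v)
  have h3 := hc v w (J u)
  have h4 := hc (J u) (J v) (J w)
  simp only [hJ, hJJ] at h1 h2 h3 h4
  linarith

/-- The sums `T v w u + T (J v) (J w) u` are opposite for consecutive cyclic permutations of the
arguments. A cycle of odd length three then forces them to vanish. -/
theorem quasi_J {T : V → V → V → ℝ} (hJ : ∀ u v w, T u (J v) w = T u v (J w))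
    (hJJ : ∀ u v w, T u v (J (J w)) = -T u v w)
    (hc : ∀ u v w, T u v w + T v w u + T w u v = 0) (u v w : V) :
    T (J u) (J v) w = -T u v w := by
  have h (u v w : V) : T v w u + T (J v) (J w) u + (T w u v + T (J w) (J u) v) = 0 := by
    have h1 := hc u (J v) (J w)
    have h2 := hc u v w
    simp only [hJ, hJJ] at h1 ⊢
    linarith
  have h1 := h u v w
  have h2 := h v w u
  have h3 := h w u v
  linarith

theorem inner_A_J (h : IsHermitianDeriv b J A) (u v w : V) :
    b (A u (J v)) w = b (A u v) (J w) := by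
  rw [h.anti, map_neg, neg_apply, h.inner_left, neg_neg]

theorem inner_JA_J (h : IsHermitianDeriv b J A) (u v w : V) :
    b (J (A u (J v))) w = b (J (A u v)) (J w) := by
  rw [h.anti, map_neg, map_neg, neg_apply, h.inner_left, neg_neg]

/-- The class `𝒲₂` is a cyclicity condition on the torsion, a multiple of `J A`, whereas `dΩ = 0` is
one on `A`. This lemma and the next one pass between the two. -/
theorem cyclic_JA_of_cyclic (h : IsHermitianDeriv b J A)
    (hc : ∀ u v w, b (A u v) w + b (A v w) u + b (A w u) v = 0) (u v w : V) :
    b (J (A u v)) w + b (J (A v w)) u + b (J (A w u)) v = 0 := by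
  have := cyclic_J (T := fun u v w ↦ b (A u v) w) h.inner_A_J
    (fun u v w ↦ by rw [h.sq, map_neg]) hc u v w
  simp only [h.inner_left]
  linarith

theorem cyclic_of_cyclic_JA (h : IsHermitianDeriv b J A)
    (hc : ∀ u v w, b (J (A u v)) w + b (J (A v w)) u + b (J (A w u)) v = 0) (u v w : V) :
    b (A u v) w + b (A v w) u + b (A w u) v = 0 := by
  have := cyclic_J (T := fun u v w ↦ b (J (A u v)) w) h.inner_JA_J
    (fun u v w ↦ by rw [h.sq, map_neg]) hc u v w
  simpa only [h.orthogonal] using this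

/-- By `quasi_J`, replacing the frame `e` by `J e` negates the trace, which is independent of the
frame. -/
theorem sum_eq_zero_of_cyclic (h : IsHermitianDeriv b J A) (he : IsOrthonormalBasis b e)
    (hc : ∀ u v w, b (A u v) w + b (A v w) u + b (A w u) v = 0) :
    ∑ i, A (e i) (e i) = 0 := by
  have hq (u v : V) : A (J u) (J v) = -A u v := by
    refine h.eq_of_forall_inner fun z ↦ ?_
    rw [map_neg, neg_apply]
    exact quasi_J (T := fun u v w ↦ b (A u v) w) h.inner_A_J
      (fun u v w ↦ by rw [h.sq, map_neg]) hc u v z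
  have := he.sum_eq_sum h.symm (h.isOrthonormalBasis_J he) A
  simp only [hq, Finset.sum_neg_distrib] at this
  calc ∑ i, A (e i) (e i) = (1 / 2 : ℝ) • (∑ i, A (e i) (e i) - -∑ i, A (e i) (e i)) := by module
    _ = 0 := by rw [this, sub_self, smul_zero]

theorem sum_swap_of_cyclic (h : IsHermitianDeriv b J A) (he : IsOrthonormalBasis b e)
    (hc : ∀ u v w, b (A u v) w + b (A v w) u + b (A w u) v = 0) :
    2 * ∑ i, ∑ j, b (A (e i) (e j)) (A (e j) (e i)) =
      ∑ i, ∑ j, b (A (e i) (e j)) (A (e i) (e j)) := by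
  have hexp (x y : V) : b x y = ∑ k, b x (e k) * b y (e k) := by rw [he.sum_mul, h.symm]
  have h1 : ∑ i, ∑ j, b (A (e i) (e j)) (A (e j) (e i)) =
      ∑ i, ∑ j, ∑ k, b (A (e i) (e j)) (e k) * b (A (e j) (e i)) (e k) :=
    Finset.sum_congr rfl fun i _ ↦ Finset.sum_congr rfl fun j _ ↦ hexp _ _
  have h2 : ∑ i, ∑ j, b (A (e i) (e j)) (A (e i) (e j)) =
      ∑ i, ∑ j, ∑ k, b (A (e i) (e j)) (e k) * b (A (e i) (e j)) (e k) :=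
    Finset.sum_congr rfl fun i _ ↦ Finset.sum_congr rfl fun j _ ↦ hexp _ _
  -- With `a_ijk = b (A e_i e_j) e_k`, skewness and cyclicity give `a_kij = a_jik - a_ijk` and
  -- `a_ikj = -a_ijk`; both products on the right become the swapped sum after relabelling.
  have h3 (i j k : ι) : b (A (e i) (e j)) (e k) * b (A (e i) (e j)) (e k) =
      b (A (e i) (e j)) (e k) * b (A (e j) (e i)) (e k)
        + b (A (e i) (e k)) (e j) * b (A (e k) (e i)) (e j) := by
    have h4 := hc (e i) (e j) (e k)
    have h5 := h.skew (e j) (e k) (e i)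
    have h6 := h.skew (e i) (e k) (e j)
    rw [h.symm (e k)] at h5 h6
    rw [h6, show b (A (e k) (e i)) (e j) = -b (A (e i) (e j)) (e k) - b (A (e j) (e k)) (e i) by
      linarith, h5]
    ring
  have h4 : ∑ i, ∑ j, ∑ k, b (A (e i) (e k)) (e j) * b (A (e k) (e i)) (e j) =
      ∑ i, ∑ j, ∑ k, b (A (e i) (e j)) (e k) * b (A (e j) (e i)) (e k) :=
    Finset.sum_congr rfl fun i _ ↦ Finset.sum_comm
  rw [h1, h2]
  simp only [h3, Finset.sum_add_distrib, h4]
  ring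

/-! #### The class `𝒲₃ ⊕ 𝒲₄` -/

/-- For fixed `i` the inner sum is a trace in `e_j`. Passing to `J e_j` gives `-J` in one factor and
`J` in the other, so the trace is its own negative. -/
theorem sum_swap_of_J_invariant (h : IsHermitianDeriv b J A) (he : IsOrthonormalBasis b e)
    (hA : ∀ u v, A (J u) (J v) = A u v) :
    ∑ i, ∑ j, b (A (e i) (e j)) (A (e j) (e i)) = 0 := by
  refine Finset.sum_eq_zero fun i _ ↦ ?_
  let B : V →ₗ[ℝ] V →ₗ[ℝ] ℝ := LinearMap.mk₂ ℝ (fun v w ↦ b (A (e i) v) (A w (e i)))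
    (by simp) (by simp) (by simp) (by simp)
  have h1 (v w : V) : B v w = b (A (e i) v) (A w (e i)) := rfl
  have := he.sum_eq_sum h.symm (h.isOrthonormalBasis_J he) B
  have h2 (v : V) : A (J v) (e i) = J (A v (e i)) := by
    have := hA v (J (e i))
    rw [h.sq, map_neg, h.anti] at this
    exact neg_injective this
  simp only [h1, h.anti, h2, map_neg, neg_apply, h.orthogonal, Finset.sum_neg_distrib] at this
  linarith

/-- The form of `∇J` for a structure of class `𝒲₄` with Lee field `T`. -/
def IsLee (b : V →L[ℝ] V →L[ℝ] ℝ) (J : V →L[ℝ] V) (A : V →ₗ[ℝ] V →ₗ[ℝ] V) (T : V) : Prop :=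
  ∀ v w, A v w = (-(1 / 2) : ℝ) • (b T w • J v - b T (J w) • v - b v w • J T + b v (J w) • T)

variable {T : V}

theorem J_invariant_of_isLee (h : IsHermitianDeriv b J A) (hT : IsLee b J A T) (u v : V) :
    A (J u) (J v) = A u v := by
  rw [hT, hT]
  simp only [h.sq, map_neg, h.orthogonal, h.inner_left u v]
  module

theorem sum_of_isLee (h : IsHermitianDeriv b J A) (he : IsOrthonormalBasis b e)
    (hT : IsLee b J A T) : ∑ i, A (e i) (e i) = ((Fintype.card ι : ℝ) / 2 - 1) • J T := by
  have h1 : ∑ i, b T (e i) • J (e i) = J T := by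
    conv_rhs => rw [← he.sum_eq T, map_sum]
    simp
  have h2 : ∑ i, b T (J (e i)) • e i = -J T := by
    rw [← he.sum_eq (J T), ← Finset.sum_neg_distrib]
    exact Finset.sum_congr rfl fun i _ ↦ by rw [h.inner_left, neg_smul, neg_neg]
  have h3 : ∑ i, b (e i) (e i) • J T = (Fintype.card ι : ℝ) • J T := by
    rw [← Finset.sum_smul, he.sum_inner_self]
  have h4 (v : V) : b v (J v) = 0 := by
    have := h.inner_left v v
    rw [h.symm] at this
    linarith
  simp only [hT _ _, ← Finset.smul_sum, Finset.sum_add_distrib, Finset.sum_sub_distrib, h1, h2, h3,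
    h4]
  simp only [zero_smul]
  module

theorem J_sum_of_isLee (h : IsHermitianDeriv b J A) (he : IsOrthonormalBasis b e)
    (hT : IsLee b J A T) : J (∑ i, A (e i) (e i)) = (-((Fintype.card ι : ℝ) / 2 - 1)) • T := by
  rw [h.sum_of_isLee he hT, map_smul, h.sq]
  module

theorem normSq_of_isLee (h : IsHermitianDeriv b J A) (he : IsOrthonormalBasis b e)
    (hT : IsLee b J A T) : ∑ i, ∑ j, b (A (e i) (e j)) (A (e i) (e j)) =
      ((Fintype.card ι : ℝ) - 2) * b T T := by
  have hself (v : V) : b v (J v) = 0 := by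
    have := h.inner_left v v
    rw [h.symm] at this
    linarith
  -- The expansion is arranged in products of two pairings with `v`, so that `sum_mul`, Parseval's
  -- identity, evaluates the sum over the frame.
  have h1 (v w : V) : 4 * b (A v w) (A v w) =
      (b T w ^ 2 + b T (J w) ^ 2) * b v v + b T T * (b w v * b w v + b (J w) v * b (J w) v)
      - 2 * b T w * (b w v * b T v) + 2 * b T w * (b (J w) v * b (-J T) v)
      + 2 * b T (J w) * (b w v * b (J T) v) - 2 * b T (J w) * (b (J w) v * b T v) := by
    rw [hT]
    simp only [map_add, map_sub, map_smul, add_apply, sub_apply, smul_apply, smul_eq_mul,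
      h.orthogonal, map_neg, neg_apply]
    simp only [h.inner_left, hself, h.symm v T, h.symm v w]
    rw [show b v (J w) = -b w (J v) by rw [h.symm, h.inner_left],
      show b v (J T) = -b T (J v) by rw [h.symm, h.inner_left]]
    ring
  -- The pairing of `T` with `J w` is written as that of `-J T` with `w`, ready for Parseval in the
  -- second index.
  have h2 (w : V) : 4 * ∑ i, b (A (e i) w) (A (e i) w) =
      ((Fintype.card ι : ℝ) - 4) * (b T w * b T w + b (-J T) w * b (-J T) w) +
        2 * b T T * b w w := by
    rw [Finset.mul_sum]
    simp only [h1, Finset.sum_add_distrib, Finset.sum_sub_distrib, ← Finset.mul_sum,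
      he.sum_inner_self, he.sum_mul]
    simp only [map_neg, neg_apply, h.orthogonal, h.inner_left T w]
    ring
  have h3 : 4 * ∑ j, ∑ i, b (A (e i) (e j)) (A (e i) (e j)) =
      4 * (((Fintype.card ι : ℝ) - 2) * b T T) := by
    rw [Finset.mul_sum]
    simp only [h2, Finset.sum_add_distrib, ← Finset.mul_sum, he.sum_inner_self, he.sum_mul]
    simp only [map_neg, neg_apply, h.orthogonal, neg_neg]
    ring
  rw [Finset.sum_comm]
  linarith

end IsHermitianDeriv

end AlmostHermitianGeometry

namespace AlmostHermitianGeometry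

variable {E : Type*} [NormedAddCommGroup E] [NormedSpace ℝ E] [FiniteDimensional ℝ E]
  {H : Type*} [TopologicalSpace H] {I : ModelWithCorners ℝ E H}
  {M : Type*} [TopologicalSpace M] [ChartedSpace H M] [IsManifold I ∞ M]

/-! ### Identities for almost Hermitian structures -/

/-- A property which holds at the points of the form `(extChartAt I x₀).symm p` holds everywhere. -/
theorem forall_of_forall_chart (I : ModelWithCorners ℝ E H) {P : M → Prop}
    (h : ∀ (x₀ : M) (p : E), p ∈ (extChartAt I x₀).target → P ((extChartAt I x₀).symm p)) (x : M) :
    P x :=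
  extChartAt_to_inv (I := I) x ▸ h x _ (mem_extChartAt_target x)

theorem exists_chartFrame_eq {x₀ : M} {p : E} (hp : p ∈ (extChartAt I x₀).target)
    (v : TangentSpace I ((extChartAt I x₀).symm p)) : ∃ w, chartFrame I x₀ p w = v :=
  ⟨_, chartFrame_chartCoframe hp v⟩

theorem isOrthonormalBasis_chartCoframe {x₀ : M} {p : E} (hp : p ∈ (extChartAt I x₀).target)
    {g : SmoothMetric I M} {ι : Type*} [Fintype ι] [DecidableEq ι]
    {e : ι → TangentSpace I ((extChartAt I x₀).symm p)}
    (he : IsOrthonormalBasis (g.inner ((extChartAt I x₀).symm p)) e) :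
    IsOrthonormalBasis (chartMetric g x₀ p) (fun i ↦ chartCoframe I x₀ p (e i)) where
  inner_eq i j := by
    rw [chartMetric_apply, chartFrame_chartCoframe hp, chartFrame_chartCoframe hp, he.inner_eq]
  sum_eq v := by
    calc ∑ i, chartMetric g x₀ p v (chartCoframe I x₀ p (e i)) • chartCoframe I x₀ p (e i)
        = chartCoframe I x₀ p (∑ i, g.inner _ (chartFrame I x₀ p v) (e i) • e i) := by
          rw [map_sum]
          refine Finset.sum_congr rfl fun i _ ↦ ?_
          rw [chartMetric_apply, chartFrame_chartCoframe hp, map_smul]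
      _ = v := by rw [he.sum_eq, chartCoframe_chartFrame hp]

namespace HermitianStructure

variable [I.Boundaryless] {g : SmoothMetric I M} (S : HermitianStructure g)

/-- `nablaJ` is defined through extensions that need not be additive in the vector, so its
bilinearity is read off from the chart formula. -/
theorem exists_bilinear_nablaJ {J : Π x : M, TangentSpace I x →L[ℝ] TangentSpace I x}
    (hJ : ContMDiff I (I.prod 𝓘(ℝ, E →L[ℝ] E)) ∞
      (fun x ↦ (TotalSpace.mk' (E →L[ℝ] E) x (J x) :
        TotalSpace (E →L[ℝ] E) (fun x : M ↦ TangentSpace I x →L[ℝ] TangentSpace I x)))) (x : M) :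
    ∃ A : TangentSpace I x →ₗ[ℝ] TangentSpace I x →ₗ[ℝ] TangentSpace I x,
      ∀ v w, A v w = nablaJ g J x v w := by
  refine forall_of_forall_chart I (P := fun x ↦
    ∃ A : TangentSpace I x →ₗ[ℝ] TangentSpace I x →ₗ[ℝ] TangentSpace I x,
      ∀ v w, A v w = nablaJ g J x v w) (fun x₀ p hp ↦ ?_) x
  refine ⟨LinearMap.mk₂ ℝ (fun v w ↦ chartFrame I x₀ p (Coord.covEnd (chartMetric g x₀)
    (chartEnd J x₀) p (chartCoframe I x₀ p v) (chartCoframe I x₀ p w)))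
    (by simp only [map_add, add_apply, implies_true])
    (by simp only [map_smul, smul_apply, implies_true])
    (by simp only [map_add, implies_true]) (by simp only [map_smul, implies_true]), fun v w ↦ ?_⟩
  rw [LinearMap.mk₂_apply, ← nablaJ_chartFrame hp hJ, chartFrame_chartCoframe hp,
    chartFrame_chartCoframe hp]

/-- The bilinear map `(v, w) ↦ (∇_v J) w`. -/
def nablaJHom (x : M) : TangentSpace I x →ₗ[ℝ] TangentSpace I x →ₗ[ℝ] TangentSpace I x :=
  (exists_bilinear_nablaJ (g := g) S.smooth x).choose

theorem nablaJHom_apply (x : M) (v w : TangentSpace I x) :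
    S.nablaJHom x v w = nablaJ g S.J x v w :=
  (exists_bilinear_nablaJ (g := g) S.smooth x).choose_spec v w

theorem isHermitianDeriv (x : M) : IsHermitianDeriv (g.inner x) (S.J x) (S.nablaJHom x) where
  symm := g.symm x
  pos := g.pos x
  sq := S.sq x
  orthogonal := S.orthogonal x
  skew := by
    simp only [nablaJHom_apply]
    refine forall_of_forall_chart I (P := fun x ↦ ∀ u v w : TangentSpace I x,
      g.inner x (nablaJ g S.J x u v) w = -g.inner x v (nablaJ g S.J x u w)) (fun x₀ p hp ↦ ?_) x
    intro u v w
    obtain ⟨u, rfl⟩ := exists_chartFrame_eq hp u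
    obtain ⟨v, rfl⟩ := exists_chartFrame_eq hp v
    obtain ⟨w, rfl⟩ := exists_chartFrame_eq hp w
    rw [nablaJ_chartFrame hp S.smooth, nablaJ_chartFrame hp S.smooth]
    exact (isHermitianOn_chartEnd S x₀).inner_covEnd (isMetricOn_chartMetric g x₀) hp u v w
  anti := by
    simp only [nablaJHom_apply]
    refine forall_of_forall_chart I (P := fun x ↦ ∀ u v : TangentSpace I x,
      nablaJ g S.J x u (S.J x v) = -S.J x (nablaJ g S.J x u v)) (fun x₀ p hp ↦ ?_) x
    intro u v
    obtain ⟨u, rfl⟩ := exists_chartFrame_eq hp u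
    obtain ⟨v, rfl⟩ := exists_chartFrame_eq hp v
    rw [nablaJ_chartFrame hp S.smooth, ← chartFrame_chartEnd _ hp, ← chartFrame_chartEnd _ hp,
      nablaJ_chartFrame hp S.smooth, ← map_neg,
      (isHermitianOn_chartEnd S x₀).covEnd_anti (isMetricOn_chartMetric g x₀) hp]

/-- The contraction `∑ (∇_{e_i} J) e_i` of `∇J`. -/
def contraction (x : M) : TangentSpace I x :=
  ∑ i, S.nablaJHom x (onb g x i) (onb g x i)

/-- The vector field `J (∑ (∇_{e_i} J) e_i)`. -/
def leeField (x : M) : TangentSpace I x :=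
  S.J x (S.contraction x)

theorem contraction_chart {x₀ : M} {p : E} (hp : p ∈ (extChartAt I x₀).target) :
    ∃ f : Fin (Module.finrank ℝ E) → E, IsOrthonormalBasis (chartMetric g x₀ p) f ∧
      chartField x₀ S.contraction p =
        ∑ i, Coord.covEnd (chartMetric g x₀) (chartEnd S.J x₀) p (f i) (f i) := by
  refine ⟨_, isOrthonormalBasis_chartCoframe hp (isOrthonormalBasis_onb g _), ?_⟩
  rw [chartField, contraction, map_sum]
  refine Finset.sum_congr rfl fun i _ ↦ ?_
  rw [← chartCoframe_chartFrame hp (Coord.covEnd _ _ p _ _), ← nablaJ_chartFrame hp S.smooth,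
    chartFrame_chartCoframe hp, nablaJHom_apply]

theorem contDiffAt_chartField_contraction {x₀ : M} {p : E} (hp : p ∈ (extChartAt I x₀).target) :
    ContDiffAt ℝ ∞ (chartField x₀ S.contraction) p :=
  Coord.contDiffAt_contraction (isMetricOn_chartMetric g x₀) (isHermitianOn_chartEnd S x₀) hp
    (isOrthonormalBasis_chartCoframe hp (isOrthonormalBasis_onb g _))
    fun _ hq ↦ S.contraction_chart hq

theorem chartField_leeField_eventuallyEq {x₀ : M} {p : E} (hp : p ∈ (extChartAt I x₀).target) :
    chartField x₀ S.leeField =ᶠ[nhds p]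
      fun q ↦ chartEnd S.J x₀ q (chartField x₀ S.contraction q) := by
  filter_upwards [(isOpen_extChartAt_target (I := I) x₀).mem_nhds hp] with q hq
  exact chartField_end S.J hq S.contraction

/-- Smooth although `onb` is chosen independently at each point. This is what later spares any
regularity of the Lee vectors. -/
theorem contMDiff_leeField : CMDiff ∞ (T% S.leeField) := by
  refine forall_of_forall_chart I (P := fun x ↦ CMDiffAt ∞ (T% S.leeField) x) fun x₀ p hp ↦ ?_
  apply contMDiffAt_of_contDiffAt_chartField hp
  refine ContDiffAt.congr_of_eventuallyEq ?_ (S.chartField_leeField_eventuallyEq hp)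
  exact (contDiffAt_chartEnd S.smooth hp).clm_apply (S.contDiffAt_chartField_contraction hp)

/-- The central identity on the manifold. Each term is matched with its coordinate version in the
basis of components of `onb`. -/
theorem scal_sub_scalStar (x : M) :
    scal g x - scalStar g S.J x = 2 * divergence g S.leeField x
      + g.inner x (S.contraction x) (S.contraction x)
      - ∑ i, ∑ j, g.inner x (S.nablaJHom x (onb g x i) (onb g x j))
          (S.nablaJHom x (onb g x j) (onb g x i)) := by
  refine forall_of_forall_chart I (P := fun x ↦ scal g x - scalStar g S.J x =
    2 * divergence g S.leeField x + g.inner x (S.contraction x) (S.contraction x)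
      - ∑ i, ∑ j, g.inner x (S.nablaJHom x (onb g x i) (onb g x j))
          (S.nablaJHom x (onb g x j) (onb g x i))) (fun x₀ p hp ↦ ?_) x
  set y := (extChartAt I x₀).symm p with hy
  set e : Fin (Module.finrank ℝ E) → E := fun i ↦ chartCoframe I x₀ p (onb g y i) with he
  have hLe (i) : onb g y i = chartFrame I x₀ p (e i) := (chartFrame_chartCoframe hp _).symm
  have key := Coord.scal_sub_scalStar (isMetricOn_chartMetric g x₀) (isHermitianOn_chartEnd S x₀) hp
    (isOrthonormalBasis_chartCoframe hp (isOrthonormalBasis_onb g y))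
    fun _ hq ↦ S.contraction_chart hq
  have hscal : scal g y = ∑ j, ∑ i, chartMetric g x₀ p
      (Coord.curv (chartMetric g x₀) p (e j) (e i) (e i)) (e j) := by
    rw [scal]
    refine Finset.sum_congr rfl fun j _ ↦ Finset.sum_congr rfl fun i _ ↦ ?_
    rw [hLe i, hLe j, curvature_chartFrame hp, chartMetric_apply]
  have hstar : scalStar g S.J y = ∑ j, ∑ i, chartMetric g x₀ p
      (Coord.curv (chartMetric g x₀) p (e j) (e i) (chartEnd S.J x₀ p (e i)))
      (chartEnd S.J x₀ p (e j)) := by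
    rw [scalStar]
    refine Finset.sum_congr rfl fun j _ ↦ Finset.sum_congr rfl fun i _ ↦ ?_
    rw [hLe i, hLe j, ← chartFrame_chartEnd _ hp, ← chartFrame_chartEnd _ hp,
      curvature_chartFrame hp, chartMetric_apply]
  have hdiv : divergence g S.leeField y = ∑ i, chartMetric g x₀ p
      (Coord.cov (chartMetric g x₀) (fun q ↦ chartEnd S.J x₀ q (chartField x₀ S.contraction q)) p
        (e i)) (e i) := by
    rw [divergence]
    refine Finset.sum_congr rfl fun i _ ↦ ?_
    rw [hLe i, nabla_chartFrame hp ((S.contMDiff_leeField y).mdifferentiableAt (by simp)),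
      Coord.cov_congr _ (S.chartField_leeField_eventuallyEq hp), chartMetric_apply]
  have hQ : ∑ i, ∑ j, g.inner y (S.nablaJHom y (onb g y i) (onb g y j))
      (S.nablaJHom y (onb g y j) (onb g y i)) = ∑ i, ∑ j, chartMetric g x₀ p
      (Coord.covEnd (chartMetric g x₀) (chartEnd S.J x₀) p (e i) (e j))
      (Coord.covEnd (chartMetric g x₀) (chartEnd S.J x₀) p (e j) (e i)) := by
    refine Finset.sum_congr rfl fun j _ ↦ Finset.sum_congr rfl fun i _ ↦ ?_
    rw [nablaJHom_apply, nablaJHom_apply, hLe i, hLe j, nablaJ_chartFrame hp S.smooth,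
      nablaJ_chartFrame hp S.smooth, chartMetric_apply]
  rw [hscal, hstar, hdiv, hQ, ← chartMetric_chartField g hp S.contraction S.contraction]
  exact key

end HermitianStructure

end AlmostHermitianGeometry

namespace AlmostHermitianGeometry

variable {E : Type*} [NormedAddCommGroup E] [NormedSpace ℝ E] [FiniteDimensional ℝ E]
  {H : Type*} [TopologicalSpace H] {I : ModelWithCorners ℝ E H}
  {M : Type*} [TopologicalSpace M] [ChartedSpace H M] [IsManifold I ∞ M]

/-! ### The Levi-Civita connection -/

section LeviCivita

variable [I.Boundaryless] {g : SmoothMetric I M} {X Y Z : Π x : M, TangentSpace I x}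

theorem inner_nabla {x : M} (hX : MDiffAt (T% X) x) (hY : MDiffAt (T% Y) x)
    (hZ : MDiffAt (T% Z) x) : g.inner x (nabla g Y x (X x)) (Z x) = koszul g X Y Z x := by
  refine forall_of_forall_chart I (P := fun x ↦ MDiffAt (T% X) x → MDiffAt (T% Y) x →
    MDiffAt (T% Z) x → g.inner x (nabla g Y x (X x)) (Z x) = koszul g X Y Z x)
    (fun x₀ p hp hX hY hZ ↦ ?_) x hX hY hZ
  rw [koszul_chart hp hX hY hZ, nabla_eq_chartFrame hp hY, chartMetric_apply,
    chartFrame_chartField hp]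
  rfl

theorem nabla_const_smul (x : M) (hY : MDiffAt (T% Y) x) (c : ℝ) (v : TangentSpace I x) :
    nabla g (fun y ↦ c • Y y) x v = c • nabla g Y x v := by
  refine forall_of_forall_chart I (P := fun x ↦ MDiffAt (T% Y) x → ∀ v : TangentSpace I x,
    nabla g (fun y ↦ c • Y y) x v = c • nabla g Y x v) (fun x₀ p hp hY v ↦ ?_) x hY v
  have hcY : MDiffAt (T% (fun y ↦ c • Y y)) ((extChartAt I x₀).symm p) :=
    mdifferentiableAt_const.smul_section hY
  have h : chartField x₀ (fun y ↦ c • Y y) = c • chartField x₀ Y := by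
    funext q
    exact map_smul (chartCoframe I x₀ q) c _
  rw [nabla_eq_chartFrame hp hcY, nabla_eq_chartFrame hp hY, h, Coord.cov, Coord.cov,
    fderiv_const_smul (differentiableAt_chartField hp hY)]
  simp only [smul_apply, Pi.smul_apply, map_smul, map_add, smul_add]

theorem divergence_const_smul (x : M) (hY : MDiffAt (T% Y) x) (c : ℝ) :
    divergence g (fun y ↦ c • Y y) x = c * divergence g Y x := by
  rw [divergence, divergence, Finset.mul_sum]
  refine Finset.sum_congr rfl fun i _ ↦ ?_
  rw [nabla_const_smul x hY, map_smul, smul_apply, smul_eq_mul]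

/-- The Levi-Civita connection is metric. -/
theorem derivInner_eq {x : M} (hY : MDiffAt (T% Y) x) (hZ : MDiffAt (T% Z) x) :
    derivInner g X Y Z x =
      g.inner x (nabla g Y x (X x)) (Z x) + g.inner x (Y x) (nabla g Z x (X x)) := by
  refine forall_of_forall_chart I (P := fun x ↦ MDiffAt (T% Y) x → MDiffAt (T% Z) x →
    derivInner g X Y Z x = g.inner x (nabla g Y x (X x)) (Z x)
      + g.inner x (Y x) (nabla g Z x (X x))) (fun x₀ p hp hY hZ ↦ ?_) x hY hZ
  have hG := isMetricOn_chartMetric g x₀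
  rw [derivInner_chart hp hY hZ, nabla_eq_chartFrame hp hY, nabla_eq_chartFrame hp hZ,
    hG.fderiv_inner hp (differentiableAt_chartField hp hY) (differentiableAt_chartField hp hZ),
    ← chartFrame_chartField hp Z, ← chartFrame_chartField hp Y, ← chartMetric_apply,
    ← chartMetric_apply, hG.fderiv_eq hp]
  simp only [Coord.cov, map_add, add_apply, chartField]
  ring

/-- The Levi-Civita connection is torsion-free. -/
theorem mlieBracket_eq {x : M} (hX : MDiffAt (T% X) x) (hY : MDiffAt (T% Y) x) :
    mlieBracket I X Y x = nabla g Y x (X x) - nabla g X x (Y x) := by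
  refine forall_of_forall_chart I (P := fun x ↦ MDiffAt (T% X) x → MDiffAt (T% Y) x →
    mlieBracket I X Y x = nabla g Y x (X x) - nabla g X x (Y x)) (fun x₀ p hp hX hY ↦ ?_) x hX hY
  rw [← chartFrame_chartField hp (mlieBracket I X Y), chartField_mlieBracket hp hX hY,
    nabla_eq_chartFrame hp hX, nabla_eq_chartFrame hp hY, ← map_sub, lieBracket_eq]
  congr 1
  simp only [Coord.cov, chartField,
    (isMetricOn_chartMetric g x₀).christoffel_symm hp (chartCoframe I x₀ p (X _))]
  abel

end LeviCivita

theorem sum_inner_onb_smul (g : SmoothMetric I M) (x : M) (v : TangentSpace I x) :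
    ∑ i, g.inner x v (onb g x i) • onb g x i = v :=
  (isOrthonormalBasis_onb g x).sum_eq v

theorem inner_sharp (g : SmoothMetric I M) (θ : Π x : M, TangentSpace I x →L[ℝ] ℝ) (x : M)
    (v : TangentSpace I x) : g.inner x (sharp g θ x) v = θ x v := by
  rw [g.symm]
  conv_rhs => rw [← sum_inner_onb_smul g x v]
  simp [sharp, mul_comm]

theorem oneFormNormSq_eq (g : SmoothMetric I M) (θ : Π x : M, TangentSpace I x →L[ℝ] ℝ) (x : M) :
    oneFormNormSq g θ x = g.inner x (sharp g θ x) (sharp g θ x) := by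
  rw [inner_sharp, oneFormNormSq, sharp, map_sum]
  simp [sq]

/-! ### Consequences of the central identity in the Gray-Hervella classes -/

namespace HermitianStructure

variable [I.Boundaryless] {g : SmoothMetric I M} (S : HermitianStructure g)

theorem nablaJNormSq_eq (x : M) : nablaJNormSq g S.J x =
    ∑ i, ∑ j, g.inner x (S.nablaJHom x (onb g x i) (onb g x j))
      (S.nablaJHom x (onb g x i) (onb g x j)) := by
  simp only [nablaJNormSq, nablaJHom_apply]

theorem torsion_eq (x : M) (v w : TangentSpace I x) :
    S.torsion x v w = (-(1 / 2) : ℝ) • S.J x (S.nablaJHom x v w) := by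
  rw [nablaJHom_apply, torsion]

theorem nablaJHom_eq (x : M) (v w : TangentSpace I x) :
    S.nablaJHom x v w = (2 : ℝ) • S.J x (S.torsion x v w) := by
  rw [torsion_eq, map_smul, S.sq]
  module

theorem mdifferentiableAt_leeField (x : M) : MDiffAt (T% S.leeField) x :=
  (S.contMDiff_leeField x).mdifferentiableAt (by simp)

theorem divergence_leeField_of_contraction_eq_zero (h : ∀ x, S.contraction x = 0) (x : M) :
    divergence g S.leeField x = 0 := by
  have h0 : S.leeField = fun y ↦ (0 : ℝ) • S.leeField y := by
    ext y
    rw [leeField, h, map_zero, smul_zero]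
  rw [h0, divergence_const_smul x (S.mdifferentiableAt_leeField x), zero_mul]

variable {S}

theorem isKahler_of_nablaJNormSq (h : ∀ x, nablaJNormSq g S.J x = 0) : S.IsKahler := by
  intro x v w
  rw [← nablaJHom_apply]
  exact (S.isHermitianDeriv x).eq_zero_of_sum (isOrthonormalBasis_onb g x)
    ((S.nablaJNormSq_eq x).symm.trans (h x)) v w

/-! #### The class `𝒲₁` -/

theorem IsW1.nablaJHom_eq_neg (h : S.IsW1) (x : M) (v w : TangentSpace I x) :
    S.nablaJHom x v w = -S.nablaJHom x w v := by
  rw [nablaJHom_eq, nablaJHom_eq, h, map_neg, smul_neg]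

/-- An alternating `∇J` has zero contraction, and swapping its arguments turns the quadratic term
into minus the norm squared. -/
theorem IsW1.scal_sub_scalStar (h : S.IsW1) (x : M) :
    scal g x - scalStar g S.J x = nablaJNormSq g S.J x := by
  have h0 (y : M) : S.contraction y = 0 := by
    refine Finset.sum_eq_zero fun i _ ↦ ?_
    have := h y (onb g y i) (onb g y i)
    rw [nablaJHom_eq]
    have h2 : S.torsion y (onb g y i) (onb g y i) = 0 := by
      calc S.torsion y (onb g y i) (onb g y i) = (1 / 2 : ℝ) • (S.torsion y (onb g y i) (onb g y i)
            - -S.torsion y (onb g y i) (onb g y i)) := by module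
        _ = 0 := by rw [← this, sub_self, smul_zero]
    rw [h2, map_zero, smul_zero]
  rw [S.scal_sub_scalStar, S.divergence_leeField_of_contraction_eq_zero h0, h0, nablaJNormSq_eq]
  have h1 (i j) : g.inner x (S.nablaJHom x (onb g x i) (onb g x j))
      (S.nablaJHom x (onb g x j) (onb g x i)) = -g.inner x (S.nablaJHom x (onb g x i) (onb g x j))
      (S.nablaJHom x (onb g x i) (onb g x j)) := by
    rw [h.nablaJHom_eq_neg x (onb g x j) (onb g x i), map_neg]
  simp [h1]

theorem IsNearlyKahler.isW1 (h : S.IsNearlyKahler) : S.IsW1 := by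
  intro x v w
  have h1 := h x (v + w)
  rw [← nablaJHom_apply] at h1
  simp only [map_add, LinearMap.add_apply] at h1
  have hv := h x v
  have hw := h x w
  rw [← nablaJHom_apply] at hv hw
  rw [hv, hw, zero_add, add_zero] at h1
  rw [torsion_eq, torsion_eq, eq_neg_of_add_eq_zero_right h1, map_neg, smul_neg]

/-! #### The class `𝒲₂` -/

theorem isW2_iff_cyclic : S.IsW2 ↔ ∀ (x : M) (u v w : TangentSpace I x),
    g.inner x (S.nablaJHom x u v) w + g.inner x (S.nablaJHom x v w) u
      + g.inner x (S.nablaJHom x w u) v = 0 := by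
  have h (x : M) (u v w : TangentSpace I x) :
      g.inner x (S.torsion x u v) w = -(1 / 2) * g.inner x (S.J x (S.nablaJHom x u v)) w := by
    rw [torsion_eq, map_smul, smul_apply, smul_eq_mul]
  constructor
  · intro h2 x
    refine (S.isHermitianDeriv x).cyclic_of_cyclic_JA fun u v w ↦ ?_
    have := h2 x u v w
    simp only [h] at this
    linarith
  · intro h1 x u v w
    have := (S.isHermitianDeriv x).cyclic_JA_of_cyclic (h1 x) u v w
    simp only [h]
    linarith

theorem IsW2.scal_sub_scalStar (h : S.IsW2) (x : M) :
    2 * (scal g x - scalStar g S.J x) = -nablaJNormSq g S.J x := by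
  have hc := isW2_iff_cyclic.1 h
  have h0 (y : M) : S.contraction y = 0 :=
    (S.isHermitianDeriv y).sum_eq_zero_of_cyclic (isOrthonormalBasis_onb g y) (hc y)
  have h1 := (S.isHermitianDeriv x).sum_swap_of_cyclic (isOrthonormalBasis_onb g x) (hc x)
  rw [S.scal_sub_scalStar, S.divergence_leeField_of_contraction_eq_zero h0, h0, nablaJNormSq_eq,
    ← h1]
  simp

/-- Differentiating `g(v, J w)` with the metric connection yields `-g((∇_u J) v, w)` plus terms in
derivatives of the extensions; torsion-freeness cancels the latter against the brackets. -/
theorem dKahlerForm_eq (x : M) (u v w : TangentSpace I x) :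
    S.dKahlerForm (FiberBundle.extend E u) (FiberBundle.extend E v) (FiberBundle.extend E w) x =
      -(g.inner x (S.nablaJHom x u v) w + g.inner x (S.nablaJHom x v w) u
        + g.inner x (S.nablaJHom x w u) v) := by
  have hd (v : TangentSpace I x) : MDiffAt (T% (FiberBundle.extend E v)) x :=
    FiberBundle.mdifferentiableAt_extend ..
  have hJd (v : TangentSpace I x) : MDiffAt (T% (fun y ↦ S.J y (FiberBundle.extend E v y))) x := by
    apply MDifferentiableAt.clm_bundle_apply (F₁ := E)
    · exact (S.smooth x).mdifferentiableAt (by simp)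
    · exact hd v
  have hA := S.isHermitianDeriv x
  have hΩ (u v w : TangentSpace I x) :
      mvfderiv I (fun y ↦ S.kahlerForm y (FiberBundle.extend E v y) (FiberBundle.extend E w y)) x u
      = g.inner x (nabla g (FiberBundle.extend E v) x u) (S.J x w)
        - g.inner x (S.J x v) (nabla g (FiberBundle.extend E w) x u)
        - g.inner x (S.nablaJHom x u v) w := by
    have h1 := derivInner_eq (g := g) (X := FiberBundle.extend E u) (hd v) (hJd w)
    rw [derivInner] at h1
    simp only [FiberBundle.extend_apply_self] at h1
    have h2 : nabla g (fun y ↦ S.J y (FiberBundle.extend E w y)) x u =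
        S.nablaJHom x u w + S.J x (nabla g (FiberBundle.extend E w) x u) := by
      rw [nablaJHom_apply, nablaJ]
      abel
    rw [h2, map_add] at h1
    have h3 := hA.skew u v w
    have h4 := hA.inner_left v (nabla g (FiberBundle.extend E w) x u)
    simp only [kahlerForm]
    linarith
  simp only [dKahlerForm, FiberBundle.extend_apply_self, hΩ, mlieBracket_eq (g := g) (hd _) (hd _)]
  simp only [kahlerForm, map_sub, sub_apply]
  rw [hA.symm (S.J x v), hA.symm (S.J x u), hA.symm (S.J x w)]
  ring

theorem IsAlmostKahler.isW2 (h : S.IsAlmostKahler) : S.IsW2 := by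
  refine isW2_iff_cyclic.2 fun x u v w ↦ ?_
  have := h x u v w
  rw [dKahlerForm_eq] at this
  linarith

/-! #### The class `𝒲₃` -/

theorem IsW3.isSC (h : S.IsW3) : S.IsSC := by
  intro x
  have h0 (y : M) : S.contraction y = 0 := by
    have := h.2 y
    calc S.contraction y = (2 : ℝ) • S.J y (S.chi y) := by
          simp only [contraction, chi, nablaJHom_eq, map_sum, Finset.smul_sum]
      _ = 0 := by rw [this, map_zero, smul_zero]
  have h1 := (S.isHermitianDeriv x).sum_swap_of_J_invariant (isOrthonormalBasis_onb g x)
    fun u v ↦ by rw [nablaJHom_eq, nablaJHom_eq, ← h.1]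
  have h2 := S.scal_sub_scalStar x
  rw [S.divergence_leeField_of_contraction_eq_zero h0, h0, h1] at h2
  simp only [map_zero, mul_zero, add_zero, sub_zero] at h2
  exact sub_eq_zero.1 h2

/-! #### The class `𝒲₄` -/

variable (S) in
/-- The vector field `T` is dual to a Lee form of the structure at every point. -/
def IsLeeField (T : Π x : M, TangentSpace I x) : Prop :=
  ∀ x, IsHermitianDeriv.IsLee (g.inner x) (S.J x) (S.nablaJHom x) (T x)

theorem IsW4With.isLeeField {θ : Π x : M, TangentSpace I x →L[ℝ] ℝ} (h : S.IsW4With θ) :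
    S.IsLeeField (sharp g θ) := by
  intro x v w
  have h1 : S.nablaJHom x v w = (-(1 / 2) : ℝ) • S.J x ((-4 : ℝ) • S.torsion x v w) := by
    rw [nablaJHom_eq, map_smul]
    module
  rw [h1, h.2]
  simp only [map_add, map_sub, map_smul, S.sq, inner_sharp]
  module

section LeeField

variable {n : ℕ} {T : Π x : M, TangentSpace I x}

theorem IsLeeField.leeField_eq (hn : Module.finrank ℝ E = 2 * n) (hT : S.IsLeeField T) (x : M) :
    S.leeField x = (-((n : ℝ) - 1)) • T x := by
  rw [leeField, contraction, (S.isHermitianDeriv x).J_sum_of_isLee (isOrthonormalBasis_onb g x)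
    (hT x), Fintype.card_fin, hn]
  push_cast
  congr 1
  ring

theorem IsLeeField.scal_sub_scalStar (hn : Module.finrank ℝ E = 2 * n) (hT : S.IsLeeField T)
    (x : M) : scal g x - scalStar g S.J x =
      2 * divergence g S.leeField x + ((n : ℝ) - 1) ^ 2 * g.inner x (T x) (T x) := by
  have hA := S.isHermitianDeriv x
  rw [S.scal_sub_scalStar, hA.sum_swap_of_J_invariant (isOrthonormalBasis_onb g x)
    (hA.J_invariant_of_isLee (hT x)), ← S.orthogonal x (S.contraction x),
    show S.J x (S.contraction x) = S.leeField x from rfl, hT.leeField_eq hn]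
  simp only [map_smul, smul_apply, smul_eq_mul]
  ring

theorem IsLeeField.nablaJNormSq_eq (hn : Module.finrank ℝ E = 2 * n) (hT : S.IsLeeField T)
    (x : M) : nablaJNormSq g S.J x = 2 * ((n : ℝ) - 1) * g.inner x (T x) (T x) := by
  rw [S.nablaJNormSq_eq, (S.isHermitianDeriv x).normSq_of_isLee (isOrthonormalBasis_onb g x) (hT x),
    Fintype.card_fin, hn]
  push_cast
  ring

theorem IsW4With.divergence_sharp (hn : Module.finrank ℝ E = 2 * n)
    {θ : Π x : M, TangentSpace I x →L[ℝ] ℝ} (h : S.IsW4With θ) (x : M) :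
    2 * ((n : ℝ) - 1) * divergence g (sharp g θ) x =
      -(scal g x - scalStar g S.J x) + ((n : ℝ) - 1) ^ 2 * oneFormNormSq g θ x := by
  have hT := h.isLeeField
  rw [hT.scal_sub_scalStar hn, oneFormNormSq_eq]
  -- For `n = 1` the Lee field vanishes and says nothing about `θ`, but both sides are zero.
  -- Otherwise `θ^♯` is a constant multiple of it, which is known to be smooth.
  rcases eq_or_ne n 1 with rfl | hn1
  · have h0 : S.leeField = fun y ↦ (0 : ℝ) • S.leeField y := by
      ext y
      rw [hT.leeField_eq hn]
      simp
    rw [h0, divergence_const_smul x (S.mdifferentiableAt_leeField x)]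
    simp
  · have hn1' : (n : ℝ) - 1 ≠ 0 := sub_ne_zero.2 (by exact_mod_cast hn1)
    have h0 : sharp g θ = fun y ↦ (-((n : ℝ) - 1)⁻¹) • S.leeField y := by
      ext y
      rw [hT.leeField_eq hn, smul_smul, neg_mul_neg, inv_mul_cancel₀ hn1', one_smul]
    conv_lhs => rw [h0]
    rw [divergence_const_smul x (S.mdifferentiableAt_leeField x)]
    field_simp
    ring

end LeeField

end HermitianStructure

end AlmostHermitianGeometry

namespace AlmostHermitianGeometry

variable {E : Type*} [NormedAddCommGroup E] [NormedSpace ℝ E] [FiniteDimensional ℝ E]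
  {H : Type*} [TopologicalSpace H] {I : ModelWithCorners ℝ E H}
  {M : Type*} [TopologicalSpace M] [ChartedSpace H M] [IsManifold I ∞ M]

/-! ### Conformal changes of the metric -/

section Conformal

variable {g g' : SmoothMetric I M} {f : M → ℝ}

theorem inner_left_injective (g : SmoothMetric I M) {x : M} {v w : TangentSpace I x}
    (h : ∀ z, g.inner x v z = g.inner x w z) : v = w := by
  rw [← sum_inner_onb_smul g x v, ← sum_inner_onb_smul g x w]
  simp only [h]

theorem derivInner_conformal
    (hg' : ∀ (y : M) (v w : TangentSpace I y), g'.inner y v w = Real.exp (f y) * g.inner y v w)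
    {x : M} (hf : MDifferentiableAt I 𝓘(ℝ, ℝ) f x) {Y Z : Π x : M, TangentSpace I x}
    (hY : MDiffAt (T% Y) x) (hZ : MDiffAt (T% Z) x) (X : Π x : M, TangentSpace I x) :
    derivInner g' X Y Z x = Real.exp (f x) *
      (mvfderiv I f x (X x) * g.inner x (Y x) (Z x) + derivInner g X Y Z x) := by
  have he : MDifferentiableAt 𝓘(ℝ, ℝ) 𝓘(ℝ, ℝ) Real.exp (f x) :=
    Real.differentiableAt_exp.mdifferentiableAt
  have h1 : mvfderiv I (Real.exp ∘ f) x (X x) = Real.exp (f x) * mvfderiv I f x (X x) := by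
    rw [mvfderiv_comp_apply x he hf, mvfderiv, mfderiv_eq_fderiv]
    change fderiv ℝ Real.exp (f x) (mvfderiv I f x (X x)) = _
    rw [Real.differentiableAt_exp.hasFDerivAt.hasDerivAt.hasFDerivAt.fderiv]
    simp [mul_comm]
  have h2 : (fun y ↦ g'.inner y (Y y) (Z y)) =
      (Real.exp ∘ f) * fun y ↦ g.inner y (Y y) (Z y) := by
    ext y
    exact hg' y _ _
  rw [derivInner, h2, mvfderiv_mul (he.comp x hf) (mdifferentiableAt_inner g hY hZ), derivInner]
  simp only [add_apply, smul_apply, smul_eq_mul, h1, Function.comp_apply]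
  ring

variable [I.Boundaryless]

/-- Compare the two Koszul formulas: bracket terms scale by `exp f`, and each differentiated inner
product contributes `df`. The factor `1/2` reflects the convention `exp f` instead of `exp (2f)`. -/
theorem nabla_conformal
    (hg' : ∀ (y : M) (v w : TangentSpace I y), g'.inner y v w = Real.exp (f y) * g.inner y v w)
    {x : M} (hf : MDifferentiableAt I 𝓘(ℝ, ℝ) f x) {Y : Π x : M, TangentSpace I x}
    (hY : MDiffAt (T% Y) x) (v : TangentSpace I x) :
    nabla g' Y x v = nabla g Y x v + (1 / 2 : ℝ) • (mvfderiv I f x v • Y x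
      + mvfderiv I f x (Y x) • v - g.inner x v (Y x) • sharp g (fun y ↦ mvfderiv I f y) x) := by
  refine inner_left_injective g' fun z ↦ ?_
  have hd (v : TangentSpace I x) : MDiffAt (T% (FiberBundle.extend E v)) x :=
    FiberBundle.mdifferentiableAt_extend ..
  have h1 := inner_nabla (g := g') (hd v) hY (hd z)
  have h2 := inner_nabla (g := g) (hd v) hY (hd z)
  rw [koszul, derivInner_conformal hg' hf hY (hd z), derivInner_conformal hg' hf (hd z) (hd v),
    derivInner_conformal hg' hf (hd v) hY, hg' x (mlieBracket _ _ _ _), hg' x (mlieBracket _ _ _ _),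
    hg' x (mlieBracket _ _ _ _)] at h1
  rw [koszul] at h2
  simp only [FiberBundle.extend_apply_self] at h1 h2
  rw [h1, hg']
  simp only [map_add, map_sub, map_smul, add_apply, sub_apply, smul_apply, smul_eq_mul, h2,
    inner_sharp]
  rw [g.symm x z v]
  ring

/-- The part `df(v) Y` of the change of connection commutes with `J` and drops out; the rest is its
commutator with `J`. -/
theorem nablaJ_conformal
    (hg' : ∀ (y : M) (v w : TangentSpace I y), g'.inner y v w = Real.exp (f y) * g.inner y v w)
    {x : M} (hf : MDifferentiableAt I 𝓘(ℝ, ℝ) f x) (S : HermitianStructure g)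
    (v w : TangentSpace I x) :
    nablaJ g' S.J x v w = nablaJ g S.J x v w + (1 / 2 : ℝ) • (mvfderiv I f x (S.J x w) • v
      - g.inner x v (S.J x w) • sharp g (fun y ↦ mvfderiv I f y) x - mvfderiv I f x w • S.J x v
      + g.inner x v w • S.J x (sharp g (fun y ↦ mvfderiv I f y) x)) := by
  have hd : MDiffAt (T% (FiberBundle.extend E w)) x := FiberBundle.mdifferentiableAt_extend ..
  have hJd : MDiffAt (T% (fun y ↦ S.J y (FiberBundle.extend E w y))) x := by
    apply MDifferentiableAt.clm_bundle_apply (F₁ := E)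
    · exact (S.smooth x).mdifferentiableAt (by simp)
    · exact hd
  rw [nablaJ, nablaJ, nabla_conformal hg' hf hd, nabla_conformal hg' hf hJd]
  simp only [FiberBundle.extend_apply_self, map_add, map_sub, map_smul]
  module

theorem HermitianStructure.IsLCK.exists_isLeeField {S : HermitianStructure g} (h : S.IsLCK) :
    ∃ T, S.IsLeeField T := by
  -- The Lee vector is minus the gradient of the local `f`, chosen separately at every point;
  -- compatibility between neighbourhoods is not required.
  refine Classical.skolem.1 fun x ↦ ?_
  obtain ⟨U, f, g', -, hx, hf, hg', hK⟩ := h x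
  refine ⟨-sharp g (fun y ↦ mvfderiv I f y) x, fun v w ↦ ?_⟩
  have h1 := nablaJ_conformal hg' ((hf x).mdifferentiableAt (by simp)) S v w
  rw [hK x hx] at h1
  rw [S.nablaJHom_apply, eq_neg_of_add_eq_zero_left h1.symm]
  simp only [map_neg, neg_apply, inner_sharp]
  module

end Conformal

end AlmostHermitianGeometry

namespace AlmostHermitianGeometry

/-! ### The Riemannian density in coordinates -/

section Determinant

open scoped Matrix

variable {ι : Type*} [Fintype ι] [DecidableEq ι]

theorem contDiff_det : ContDiff ℝ ∞ (fun N : ι → ι → ℝ ↦ (Matrix.of N).det) := by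
  simp only [Matrix.det_apply, Matrix.of_apply]
  fun_prop

theorem hasDerivAt_det_one_add_smul (A : Matrix ι ι ℝ) :
    HasDerivAt (fun t : ℝ ↦ (1 + t • A).det) A.trace 0 := by
  -- The remainder in `det (1 + t A) = 1 + t tr A + t² q(t)`; its contribution has zero derivative
  -- at `0`.
  let q := (Matrix.det (1 + (Polynomial.X : Polynomial ℝ) • A.map Polynomial.C)).divX.divX
  have h := (((hasDerivAt_id (0 : ℝ)).const_mul A.trace).const_add 1).add
    ((q.hasDerivAt 0).mul (hasDerivAt_pow 2 (0 : ℝ)))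
  refine (h.congr_deriv (by simp)).congr_of_eventuallyEq (.of_forall fun t ↦ ?_)
  exact Matrix.det_one_add_smul t A

/-- The derivative of the determinant in a direction of the form `Aᵀ N + N A`. -/
theorem fderiv_det_transpose_mul_add_mul (N A : Matrix ι ι ℝ) :
    fderiv ℝ (fun N : ι → ι → ℝ ↦ (Matrix.of N).det) N (Aᵀ * N + N * A : Matrix ι ι ℝ) =
      2 * A.trace * N.det := by
  -- This curve is `(1 + t A)ᵀ N (1 + t A)`, with the prescribed velocity at `0` and determinant
  -- `det (1 + t A)² det N`; no invertibility of `N` is involved.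
  let c : ℝ → ι → ι → ℝ := fun t i j ↦ N i j + t * (Aᵀ * N + N * A) i j + t ^ 2 * (Aᵀ * N * A) i j
  have hc0 : c 0 = N := by
    ext i j
    simp [c]
  have hc : HasDerivAt c (Aᵀ * N + N * A : Matrix ι ι ℝ) 0 := by
    refine hasDerivAt_pi.2 fun i ↦ hasDerivAt_pi.2 fun j ↦ ?_
    have h := (((hasDerivAt_id (0 : ℝ)).mul_const ((Aᵀ * N + N * A) i j)).const_add (N i j)).add
      ((hasDerivAt_pow 2 (0 : ℝ)).mul_const ((Aᵀ * N * A) i j))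
    exact (h.congr_deriv (by simp)).congr_of_eventuallyEq (.of_forall fun t ↦ rfl)
  have hd : DifferentiableAt ℝ (fun N : ι → ι → ℝ ↦ (Matrix.of N).det) (c 0) :=
    contDiff_det.differentiable (by simp) _
  have h1 := hd.hasFDerivAt.comp_hasDerivAt 0 hc
  have h2 (t : ℝ) : (Matrix.of (c t)).det = (1 + t • A).det ^ 2 * N.det := by
    have : Matrix.of (c t) = (1 + t • A)ᵀ * N * (1 + t • A) := by
      calc Matrix.of (c t) = N + t • (Aᵀ * N + N * A) + t ^ 2 • (Aᵀ * N * A) := rfl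
        _ = _ := by
          simp only [Matrix.transpose_add, Matrix.transpose_one, Matrix.transpose_smul, add_mul,
            mul_add, one_mul, mul_one, smul_mul_assoc, mul_smul_comm]
          module
    rw [this, Matrix.det_mul, Matrix.det_mul, Matrix.det_transpose]
    ring
  have h3 : HasDerivAt ((fun N : ι → ι → ℝ ↦ (Matrix.of N).det) ∘ c)
      (2 * A.trace * N.det) 0 := by
    have h := ((hasDerivAt_det_one_add_smul A).pow 2).mul_const N.det
    refine (h.congr_of_eventuallyEq (.of_forall h2)).congr_deriv ?_
    simp
  rw [← hc0]
  rw [hc0] at h1 ⊢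
  exact h1.unique h3

end Determinant

namespace Coord

variable {E : Type*} [NormedAddCommGroup E] [NormedSpace ℝ E] [FiniteDimensional ℝ E]
  {G : E → E →L[ℝ] E →L[ℝ] ℝ} {U : Set E}

/-- The Gram matrix of a bilinear form with respect to a fixed basis. -/
def gram (b : E →L[ℝ] E →L[ℝ] ℝ) (i j : Fin (Module.finrank ℝ E)) : ℝ :=
  b (Module.finBasis ℝ E i) (Module.finBasis ℝ E j)

/-- The Riemannian density of the metric `G`. -/
def density (G : E → E →L[ℝ] E →L[ℝ] ℝ) (p : E) : ℝ :=
  √(Matrix.of (gram (G p))).det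

theorem gram_comp (b : E →L[ℝ] E →L[ℝ] ℝ) (A B : E →L[ℝ] E) (i j) :
    b (A (Module.finBasis ℝ E i)) (B (Module.finBasis ℝ E j)) =
      ((LinearMap.toMatrix (Module.finBasis ℝ E) (Module.finBasis ℝ E) A).transpose *
        Matrix.of (gram b) *
        LinearMap.toMatrix (Module.finBasis ℝ E) (Module.finBasis ℝ E) B) i j := by
  have h (A : E →L[ℝ] E) (i) : A (Module.finBasis ℝ E i) =
      ∑ k, LinearMap.toMatrix (Module.finBasis ℝ E) (Module.finBasis ℝ E) A k i •
        Module.finBasis ℝ E k := by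
    conv_lhs => rw [← (Module.finBasis ℝ E).sum_repr (A (Module.finBasis ℝ E i))]
    simp [LinearMap.toMatrix_apply]
  rw [h A, h B]
  simp only [map_sum, map_smul, sum_apply, smul_apply, smul_eq_mul,
    Matrix.mul_apply, Matrix.transpose_apply, Matrix.of_apply, gram, Finset.mul_sum,
    Finset.sum_mul]
  refine Finset.sum_congr rfl fun k _ ↦ Finset.sum_congr rfl fun l _ ↦ ?_
  ring

theorem density_eq_of_comp {G G' : E → E →L[ℝ] E →L[ℝ] ℝ} {p q : E} (A : E →L[ℝ] E)
    (h : ∀ v w, G p v w = G' q (A v) (A w)) : density G p = |A.det| * density G' q := by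
  have : Matrix.of (gram (G p)) =
      (LinearMap.toMatrix (Module.finBasis ℝ E) (Module.finBasis ℝ E) A).transpose *
        Matrix.of (gram (G' q)) *
        LinearMap.toMatrix (Module.finBasis ℝ E) (Module.finBasis ℝ E) A := by
    ext i j
    rw [← gram_comp, ← h]
    rfl
  rw [density, this, Matrix.det_mul, Matrix.det_mul, Matrix.det_transpose, LinearMap.det_toMatrix,
    mul_comm, ← mul_assoc, Real.sqrt_mul (mul_self_nonneg _), Real.sqrt_mul_self_eq_abs]
  rfl

namespace IsMetricOn

theorem det_gram_pos (hG : IsMetricOn G U) {p : E} (hp : p ∈ U) :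
    0 < (Matrix.of (gram (G p))).det := by
  refine (Matrix.PosDef.of_dotProduct_mulVec_pos ?_ fun x hx ↦ ?_).det_pos
  · ext i j
    exact hG.symm p hp _ _
  · have h : star x ⬝ᵥ (Matrix.of (gram (G p))).mulVec x =
        G p (∑ i, x i • Module.finBasis ℝ E i) (∑ i, x i • Module.finBasis ℝ E i) := by
      simp only [dotProduct, Matrix.mulVec, map_sum, map_smul, sum_apply,
        smul_apply, smul_eq_mul, Finset.mul_sum, Matrix.of_apply, gram, Pi.star_apply, star_trivial]
      rw [Finset.sum_comm]
      refine Finset.sum_congr rfl fun k _ ↦ Finset.sum_congr rfl fun l _ ↦ ?_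
      ring
    rw [h]
    refine hG.pos p hp _ fun h0 ↦ hx ?_
    ext i
    exact Fintype.linearIndependent_iff.1 (Module.finBasis ℝ E).linearIndependent x h0 i

theorem density_pos (hG : IsMetricOn G U) {p : E} (hp : p ∈ U) : 0 < density G p :=
  Real.sqrt_pos.2 (hG.det_gram_pos hp)

theorem contDiffAt_gram (hG : IsMetricOn G U) {p : E} (hp : p ∈ U) :
    ContDiffAt ℝ ∞ (fun q ↦ gram (G q)) p :=
  contDiffAt_pi.2 fun _ ↦ contDiffAt_pi.2 fun _ ↦
    ((hG.contDiffAt p hp).clm_apply contDiffAt_const).clm_apply contDiffAt_const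

theorem contDiffAt_density (hG : IsMetricOn G U) {p : E} (hp : p ∈ U) :
    ContDiffAt ℝ ∞ (density G) p :=
  (contDiff_det.contDiffAt.comp p (hG.contDiffAt_gram hp)).sqrt (hG.det_gram_pos hp).ne'

/-- Metric compatibility says that the Gram matrix `N` has derivative `Aᵀ N + N A`, where `A` is the
matrix of the Christoffel endomorphism. The determinant then has logarithmic derivative `2 tr A`,
and the square root halves it. -/
theorem fderiv_density (hG : IsMetricOn G U) {p : E} (hp : p ∈ U) (v : E) :
    fderiv ℝ (density G) p v =
      LinearMap.trace ℝ E (christoffel G p v) * density G p := by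
  set A := LinearMap.toMatrix (Module.finBasis ℝ E) (Module.finBasis ℝ E)
    (christoffel G p v : E →ₗ[ℝ] E) with hA
  have hgram := (hG.contDiffAt_gram hp).differentiableAt (by simp)
  have h1 : fderiv ℝ (fun q ↦ gram (G q)) p v =
      (A.transpose * Matrix.of (gram (G p)) + Matrix.of (gram (G p)) * A : Matrix _ _ ℝ) := by
    ext i j
    have h2 := gram_comp (G p) (christoffel G p v) (.id ℝ E) i j
    have h3 := gram_comp (G p) (.id ℝ E) (christoffel G p v) i j
    simp only [ContinuousLinearMap.coe_id, LinearMap.toMatrix_id, mul_one, one_mul,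
      Matrix.transpose_one, ContinuousLinearMap.id_apply] at h2 h3
    rw [Matrix.add_apply, hA, ← h2, ← h3, ← hG.fderiv_eq hp]
    have h4 : HasFDerivAt (fun q ↦ gram (G q) i j) _ p :=
      hasFDerivAt_pi'.1 (hasFDerivAt_pi'.1 hgram.hasFDerivAt i) j
    have h5 := hG.fderiv_inner hp (differentiableAt_const (Module.finBasis ℝ E i))
      (differentiableAt_const (Module.finBasis ℝ E j)) v
    rw [fderiv_const_apply, fderiv_const_apply, zero_apply, map_zero, map_zero, zero_apply,
      add_zero, add_zero] at h5
    rw [← h5]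
    exact (congrArg (fun α : E →L[ℝ] ℝ ↦ α v) h4.fderiv).symm
  have hdet : DifferentiableAt ℝ
      (fun N : Fin (Module.finrank ℝ E) → Fin (Module.finrank ℝ E) → ℝ ↦ (Matrix.of N).det)
      (gram (G p)) := contDiff_det.differentiable (by simp) _
  have h2 := (hdet.hasFDerivAt.comp p hgram.hasFDerivAt).sqrt (hG.det_gram_pos hp).ne'
  have h3 : fderiv ℝ (density G) p v = _ := congrArg (fun α : E →L[ℝ] ℝ ↦ α v) h2.fderiv
  rw [h3, smul_apply, ContinuousLinearMap.comp_apply, h1]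
  have h4 := fderiv_det_transpose_mul_add_mul (Matrix.of (gram (G p))) A
  have h5 : √(Matrix.of (gram (G p))).det ≠ 0 := (hG.density_pos hp).ne'
  have h6 := Real.mul_self_sqrt (hG.det_gram_pos hp).le
  rw [LinearMap.trace_eq_matrix_trace ℝ (Module.finBasis ℝ E), ← hA]
  refine (congrArg (fun r ↦ 1 / (2 * √(Matrix.of (gram (G p))).det) * r) h4).trans ?_
  rw [density, ← h6]
  field_simp
  rw [Real.sq_sqrt (sq_nonneg _)]

end IsMetricOn

end Coord

end AlmostHermitianGeometry

namespace AlmostHermitianGeometry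

/-! ### The divergence in coordinates -/

theorem IsOrthonormalBasis.trace_eq {V ι : Type*} [NormedAddCommGroup V]
    [NormedSpace ℝ V] [FiniteDimensional ℝ V] [Fintype ι] [DecidableEq ι]
    {b : V →L[ℝ] V →L[ℝ] ℝ} {e : ι → V}
    (he : IsOrthonormalBasis b e) (A : V →ₗ[ℝ] V) :
    LinearMap.trace ℝ V A = ∑ i, b (A (e i)) (e i) := by
  have h : A = ∑ i, ((ContinuousLinearMap.toLinearMap (b.flip (e i))).smulRight (A (e i))) := by
    ext v
    conv_lhs => rw [← he.sum_eq v]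
    simp
  conv_lhs => rw [h]
  simp

namespace Coord

open MeasureTheory

variable {E : Type*} [NormedAddCommGroup E] [NormedSpace ℝ E] [FiniteDimensional ℝ E]
  {G : E → E →L[ℝ] E →L[ℝ] ℝ} {U : Set E}

/-- The divergence of the vector field `X` with respect to the metric `G`. -/
def divergence (G : E → E →L[ℝ] E →L[ℝ] ℝ) (X : E → E) (p : E) : ℝ :=
  LinearMap.trace ℝ E (fderiv ℝ X p) + LinearMap.trace ℝ E (christoffel G p (X p))

namespace IsMetricOn

theorem sum_cov_eq_divergence (hG : IsMetricOn G U) {p : E} (hp : p ∈ U) (X : E → E) {ι : Type*}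
    [Fintype ι] [DecidableEq ι] {e : ι → E} (he : IsOrthonormalBasis (G p) e) :
    ∑ i, G p (cov G X p (e i)) (e i) = divergence G X p := by
  rw [divergence, he.trace_eq, he.trace_eq, ← Finset.sum_add_distrib]
  refine Finset.sum_congr rfl fun i _ ↦ ?_
  rw [cov, hG.christoffel_symm hp, map_add, add_apply]
  rfl

/-- The logarithmic derivative of the density is the Christoffel trace, so the Riemannian divergence
becomes a Euclidean one after weighting. -/
theorem trace_fderiv_density_smul (hG : IsMetricOn G U) {p : E} (hp : p ∈ U) {X : E → E}
    (hX : DifferentiableAt ℝ X p) :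
    LinearMap.trace ℝ E (fderiv ℝ (fun q ↦ density G q • X q) p) =
      density G p * divergence G X p := by
  have hd := (hG.contDiffAt_density hp).differentiableAt (by simp)
  have h : (fderiv ℝ (fun q ↦ density G q • X q) p : E →ₗ[ℝ] E) =
      density G p • (fderiv ℝ X p : E →ₗ[ℝ] E) +
        (ContinuousLinearMap.toLinearMap (fderiv ℝ (density G) p)).smulRight (X p) := by
    rw [fderiv_fun_smul hd hX]
    rfl
  rw [h, map_add, map_smul, LinearMap.trace_smulRight, divergence, ContinuousLinearMap.coe_coe,
    hG.fderiv_density hp, smul_eq_mul]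
  ring

theorem continuousAt_divergence (hG : IsMetricOn G U) {p : E} (hp : p ∈ U) {X : E → E}
    (hX : ContDiffAt ℝ ∞ X p) : ContinuousAt (divergence G X) p := by
  have htr : Continuous fun A : E →L[ℝ] E ↦ LinearMap.trace ℝ E (A : E →ₗ[ℝ] E) :=
    LinearMap.continuous_of_finiteDimensional
      ((LinearMap.trace ℝ E) ∘ₗ (ContinuousLinearMap.coeLM ℝ))
  have h1 : ContinuousAt (fderiv ℝ X) p := (hX.fderiv_right (m := ∞) (by simp)).continuousAt
  have h2 : ContinuousAt (fun q ↦ christoffel G q (X q)) p :=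
    ((hG.contDiffAt_christoffel hp).clm_apply hX).continuousAt
  exact (htr.continuousAt.comp h1).add (htr.continuousAt.comp h2)

end IsMetricOn

theorem integral_trace_fderiv_eq_zero [MeasurableSpace E] [BorelSpace E] (μ : Measure E)
    [μ.IsAddHaarMeasure] {Y : E → E} (hY : ContDiff ℝ ∞ Y) (hc : HasCompactSupport Y) :
    ∫ p, LinearMap.trace ℝ E (fderiv ℝ Y p) ∂μ = 0 := by
  let b := Module.finBasis ℝ E
  let y (i) (p : E) : ℝ := b.equivFunL (Y p) i
  have hy (i) : ContDiff ℝ ∞ (y i) :=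
    contDiff_pi.1 (b.equivFunL.contDiff.comp hY) i
  have hyc (i) : HasCompactSupport (y i) := by
    refine hc.comp_left (g := fun v ↦ b.equivFunL v i) ?_
    simp
  have hfd (i) (p v : E) : fderiv ℝ (y i) p v = b.repr (fderiv ℝ Y p v) i := by
    have h := b.equivFunL.hasFDerivAt.comp p
      (hY.differentiable (by simp) p).hasFDerivAt
    exact congrArg (fun α : E →L[ℝ] ℝ ↦ α v) (hasFDerivAt_pi'.1 h i).fderiv
  have h1 (p : E) : LinearMap.trace ℝ E (fderiv ℝ Y p) = ∑ i, fderiv ℝ (y i) p (b i) := by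
    rw [LinearMap.trace_eq_matrix_trace ℝ b, Matrix.trace]
    refine Finset.sum_congr rfl fun i _ ↦ ?_
    rw [Matrix.diag_apply, LinearMap.toMatrix_apply, hfd]
    rfl
  have hint (i) : Integrable (fun p ↦ fderiv ℝ (y i) p (b i)) μ :=
    (((hy i).continuous_fderiv (by simp)).clm_apply continuous_const).integrable_of_hasCompactSupport
      ((hyc i).fderiv_apply ℝ (b i))
  simp only [h1]
  rw [integral_finsetSum _ fun i _ ↦ hint i]
  refine Finset.sum_eq_zero fun i _ ↦ ?_
  -- Integration by parts against the constant function `1`.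
  have h2 := integral_mul_fderiv_eq_neg_fderiv_mul_of_integrable (μ := μ) (f := fun _ : E ↦ (1 : ℝ))
    (g := y i) (v := b i) (by simp) (by simpa using hint i)
    (by simpa using (hy i).continuous.integrable_of_hasCompactSupport (hyc i))
    (fun _ _ ↦ differentiableAt_const _) (fun p _ ↦ (hy i).differentiable (by simp) p)
  simpa using h2

/-- The divergence theorem for compactly supported vector fields in a coordinate domain. -/
theorem IsMetricOn.integral_density_mul_divergence_eq_zero [MeasurableSpace E] [BorelSpace E]
    (μ : Measure E) [μ.IsAddHaarMeasure] (hG : IsMetricOn G U) {X : E → E}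
    (hX : ∀ p ∈ U, ContDiffAt ℝ ∞ X p) {K : Set E} (hK : IsCompact K) (hKU : K ⊆ U)
    (h0 : ∀ p ∈ U, p ∉ K → X p = 0) :
    ∫ p in U, density G p * divergence G X p ∂μ = 0 := by
  -- Extension by zero stays smooth because the field vanishes off the compact set `K` inside `U`.
  let Y : E → E := U.indicator fun q ↦ density G q • X q
  have hY0 (p : E) (hp : p ∉ K) : Y p = 0 := by
    by_cases hpU : p ∈ U
    · simp [Y, h0 p hpU hp]
    · exact Set.indicator_of_notMem hpU _
  have hYU (p : E) (hp : p ∈ U) : Y =ᶠ[nhds p] fun q ↦ density G q • X q := by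
    filter_upwards [hG.isOpen.mem_nhds hp] with q hq using Set.indicator_of_mem hq _
  have hYK (p : E) (hp : p ∉ K) : Y =ᶠ[nhds p] 0 := by
    filter_upwards [hK.isClosed.isOpen_compl.mem_nhds hp] with q hq using hY0 q hq
  have hY : ContDiff ℝ ∞ Y := by
    rw [contDiff_iff_contDiffAt]
    intro p
    by_cases hp : p ∈ K
    · exact ((hG.contDiffAt_density (hKU hp)).smul (hX p (hKU hp))).congr_of_eventuallyEq
        (hYU p (hKU hp))
    · exact contDiffAt_const.congr_of_eventuallyEq (hYK p hp)
  have hc : HasCompactSupport Y := HasCompactSupport.intro hK hY0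
  rw [← integral_trace_fderiv_eq_zero μ hY hc]
  have h1 : ∀ p ∈ U, density G p * divergence G X p = LinearMap.trace ℝ E (fderiv ℝ Y p) := by
    intro p hp
    rw [(hYU p hp).fderiv_eq, hG.trace_fderiv_density_smul hp
      ((hX p hp).differentiableAt (by simp))]
  rw [setIntegral_congr_fun hG.isOpen.measurableSet h1]
  refine setIntegral_eq_integral_of_forall_compl_eq_zero fun p hp ↦ ?_
  rw [(hYK p fun h ↦ hp (hKU h)).fderiv_eq]
  simp

end Coord

end AlmostHermitianGeometry

namespace AlmostHermitianGeometry

/-! ### The divergence theorem on closed manifolds -/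

section DivergenceTheorem

open MeasureTheory

variable {E : Type*} [NormedAddCommGroup E] [NormedSpace ℝ E] [FiniteDimensional ℝ E]
  {H : Type*} [TopologicalSpace H] {I : ModelWithCorners ℝ E H}
  {M : Type*} [TopologicalSpace M] [ChartedSpace H M] [IsManifold I ∞ M] [I.Boundaryless]
  {g : SmoothMetric I M} {x₀ : M} {p : E}

theorem divergence_eq_coord (hp : p ∈ (extChartAt I x₀).target) {X : Π x : M, TangentSpace I x}
    (hX : MDiffAt (T% X) ((extChartAt I x₀).symm p)) :
    divergence g X ((extChartAt I x₀).symm p) =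
      Coord.divergence (chartMetric g x₀) (chartField x₀ X) p := by
  rw [← (isMetricOn_chartMetric g x₀).sum_cov_eq_divergence hp _
    (isOrthonormalBasis_chartCoframe hp (isOrthonormalBasis_onb g _)), divergence]
  refine Finset.sum_congr rfl fun i _ ↦ ?_
  rw [nabla_eq_chartFrame hp hX, chartMetric_apply, chartFrame_chartCoframe hp]

theorem divergence_eq_zero_of_eventually {X : Π x : M, TangentSpace I x} {x : M}
    (hX : MDiffAt (T% X) x) (h0 : ∀ᶠ y in nhds x, X y = 0) : divergence g X x = 0 := by
  refine forall_of_forall_chart I (P := fun x ↦ MDiffAt (T% X) x → (∀ᶠ y in nhds x, X y = 0) →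
    divergence g X x = 0) (fun x₀ p hp hX h0 ↦ ?_) x hX h0
  have h : chartField x₀ X =ᶠ[nhds p] fun _ ↦ 0 := by
    filter_upwards [(contMDiffAt_extChartAt_symm_of_mem hp).continuousAt.eventually h0] with q hq
    rw [chartField, hq, map_zero]
  rw [divergence_eq_coord hp hX, Coord.divergence, h.fderiv_eq, h.eq_of_nhds, map_zero]
  simp

theorem continuous_of_chart {F : Type*} [TopologicalSpace F] {f : M → F}
    (h : ∀ (x₀ : M) (p : E), p ∈ (extChartAt I x₀).target →
      ContinuousAt (fun q ↦ f ((extChartAt I x₀).symm q)) p) : Continuous f := by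
  refine continuous_iff_continuousAt.2 fun x ↦ ?_
  have h1 := (h x _ (mem_extChartAt_target x)).comp (continuousAt_extChartAt (I := I) x)
  refine h1.congr ?_
  filter_upwards [extChartAt_source_mem_nhds (I := I) x] with y hy
  simp only [Function.comp_apply, (extChartAt I x).left_inv hy]

theorem continuous_divergence {X : Π x : M, TangentSpace I x} (hX : CMDiff ∞ (T% X)) :
    Continuous (divergence g X) := by
  refine continuous_of_chart (I := I) fun x₀ p hp ↦ ?_
  refine ((isMetricOn_chartMetric g x₀).continuousAt_divergence hp
    (contDiffAt_chartField hp (hX _))).congr ?_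
  filter_upwards [(isOpen_extChartAt_target (I := I) x₀).mem_nhds hp] with q hq
  exact (divergence_eq_coord hq ((hX _).mdifferentiableAt (by simp))).symm

theorem chartMetric_extChartAt {x z : M} (hz : z ∈ (extChartAt I x).source) (v w : E) :
    chartMetric g x (extChartAt I x z) v w =
      g.inner z (tangentCoordChange I x z z v) (tangentCoordChange I x z z w) := by
  rw [chartMetric_apply]
  unfold chartFrame
  rw [(extChartAt I x).left_inv hz]
  rw [extChartAt_source] at hz
  rw [TangentBundle.symmL_trivializationAt_eq_core hz]
  rfl

/-- Both charts are compared with the chart centred at `z` through the cocycle identity. -/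
theorem chartMetric_coordChange {x y z : M} (hx : z ∈ (extChartAt I x).source)
    (hy : z ∈ (extChartAt I y).source) (v w : E) :
    chartMetric g x (extChartAt I x z) v w = chartMetric g y (extChartAt I y z)
      (tangentCoordChange I x y z v) (tangentCoordChange I x y z w) := by
  have hz : z ∈ (extChartAt I x).source ∩ (extChartAt I y).source ∩ (extChartAt I z).source :=
    ⟨⟨hx, hy⟩, mem_extChartAt_source z⟩
  rw [chartMetric_extChartAt hx, chartMetric_extChartAt hy, tangentCoordChange_comp hz,
    tangentCoordChange_comp hz]

variable [MeasurableSpace E] [BorelSpace E]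

/-- The integral over the domain of the chart at `x₀` with respect to the Riemannian density. -/
def chartIntegral (g : SmoothMetric I M) (x₀ : M) (f : M → ℝ) : ℝ :=
  ∫ p in (extChartAt I x₀).target,
    Coord.density (chartMetric g x₀) p * f ((extChartAt I x₀).symm p) ∂(Measure.addHaar : Measure E)

/-- Change of variables on the overlap: the Jacobian determinant is exactly the factor by which the
two densities differ. -/
theorem chartIntegral_congr_of_support {x y : M} {f : M → ℝ}
    (h0 : ∀ z, f z ≠ 0 → z ∈ (extChartAt I x).source ∧ z ∈ (extChartAt I y).source) :
    chartIntegral g x f = chartIntegral g y f := by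
  have hs (x y : M) :
      IsOpen ((extChartAt I x).target ∩ (extChartAt I x).symm ⁻¹' (extChartAt I y).source) :=
    (continuousOn_extChartAt_symm x).isOpen_inter_preimage (isOpen_extChartAt_target x)
      (isOpen_extChartAt_source y)
  have hI (x y : M) (h0 : ∀ z, f z ≠ 0 → z ∈ (extChartAt I y).source) : chartIntegral g x f =
      ∫ p in (extChartAt I x).target ∩ (extChartAt I x).symm ⁻¹' (extChartAt I y).source,
        Coord.density (chartMetric g x) p * f ((extChartAt I x).symm p)
          ∂(Measure.addHaar : Measure E) := by
    refine setIntegral_eq_of_subset_of_forall_sdiff_eq_zero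
      (isOpen_extChartAt_target x).measurableSet Set.inter_subset_left fun p hp ↦ ?_
    by_contra hne
    exact hp.2 ⟨hp.1, h0 _ (right_ne_zero_of_mul hne)⟩
  rw [hI x y fun z hz ↦ (h0 z hz).2, hI y x fun z hz ↦ (h0 z hz).1]
  have himage : (extChartAt I y ∘ (extChartAt I x).symm) ''
      ((extChartAt I x).target ∩ (extChartAt I x).symm ⁻¹' (extChartAt I y).source) =
      (extChartAt I y).target ∩ (extChartAt I y).symm ⁻¹' (extChartAt I x).source := by
    ext q
    constructor
    · rintro ⟨p, hp, rfl⟩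
      refine ⟨(extChartAt I y).map_source hp.2, ?_⟩
      simp only [Set.mem_preimage, Function.comp_apply, (extChartAt I y).left_inv hp.2]
      exact (extChartAt I x).map_target hp.1
    · rintro ⟨hq, hq'⟩
      refine ⟨extChartAt I x ((extChartAt I y).symm q), ⟨(extChartAt I x).map_source hq', ?_⟩, ?_⟩
      · simp only [Set.mem_preimage, (extChartAt I x).left_inv hq']
        exact (extChartAt I y).map_target hq
      · simp only [Function.comp_apply, (extChartAt I x).left_inv hq',
          (extChartAt I y).right_inv hq]
  have hinj : Set.InjOn (extChartAt I y ∘ (extChartAt I x).symm)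
      ((extChartAt I x).target ∩ (extChartAt I x).symm ⁻¹' (extChartAt I y).source) := by
    intro p hp q hq hpq
    exact (extChartAt I x).symm.injOn hp.1 hq.1 ((extChartAt I y).injOn hp.2 hq.2 hpq)
  rw [← himage, integral_image_eq_integral_abs_det_fderiv_smul Measure.addHaar
    (hs x y).measurableSet (f' := fun p ↦ tangentCoordChange I x y ((extChartAt I x).symm p)) ?_ hinj]
  · refine setIntegral_congr_fun (hs x y).measurableSet fun p hp ↦ ?_
    obtain ⟨z, hz, rfl⟩ : ∃ z ∈ (extChartAt I x).source, extChartAt I x z = p :=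
      ⟨_, (extChartAt I x).map_target hp.1, (extChartAt I x).right_inv hp.1⟩
    have hzy : z ∈ (extChartAt I y).source := by
      have := hp.2
      rwa [Set.mem_preimage, (extChartAt I x).left_inv hz] at this
    simp only [Function.comp_apply, (extChartAt I x).left_inv hz, (extChartAt I y).left_inv hzy,
      smul_eq_mul]
    rw [Coord.density_eq_of_comp _ (chartMetric_coordChange hz hzy), mul_assoc]
  · intro p hp
    have := hasFDerivWithinAt_tangentCoordChange (I := I) (x := x) (y := y)
      ⟨(extChartAt I x).map_target hp.1, hp.2⟩
    rw [(extChartAt I x).right_inv hp.1] at this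
    exact this.mono (by simp [I.range_eq_univ])

theorem continuousOn_density_mul {f : M → ℝ} (hf : Continuous f) :
    ContinuousOn (fun p ↦ Coord.density (chartMetric g x₀) p * f ((extChartAt I x₀).symm p))
      (extChartAt I x₀).target :=
  (continuousOn_of_forall_continuousAt fun _ hp ↦
    ((isMetricOn_chartMetric g x₀).contDiffAt_density hp).continuousAt).mul
    (hf.comp_continuousOn (continuousOn_extChartAt_symm x₀))

section Compact

variable {C : Set M} (hC : IsCompact C) (hCx : C ⊆ (extChartAt I x₀).source)

include hC hCx

theorem chartIntegral_divergence_eq_zero {X : Π x : M, TangentSpace I x} (hX : CMDiff ∞ (T% X))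
    (h0 : ∀ x ∉ C, X x = 0) : chartIntegral g x₀ (divergence g X) = 0 := by
  rw [← (isMetricOn_chartMetric g x₀).integral_density_mul_divergence_eq_zero Measure.addHaar
    (fun p hp ↦ contDiffAt_chartField hp (hX _))
    (hC.image_of_continuousOn ((continuousOn_extChartAt x₀).mono hCx))
    (Set.image_subset_iff.2 fun z hz ↦ (extChartAt I x₀).map_source (hCx hz)) fun p hp hpC ↦ ?_]
  · refine setIntegral_congr_fun (isOpen_extChartAt_target x₀).measurableSet fun p hp ↦ ?_
    rw [divergence_eq_coord hp ((hX _).mdifferentiableAt (by simp))]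
  · rw [chartField, h0, map_zero]
    exact fun h ↦ hpC ⟨_, h, (extChartAt I x₀).right_inv hp⟩

theorem integrableOn_density_mul {f : M → ℝ} (hf : Continuous f) (h0 : ∀ x ∉ C, f x = 0) :
    IntegrableOn (fun p ↦ Coord.density (chartMetric g x₀) p * f ((extChartAt I x₀).symm p))
      (extChartAt I x₀).target (Measure.addHaar : Measure E) := by
  have hK := hC.image_of_continuousOn ((continuousOn_extChartAt (I := I) x₀).mono hCx)
  have hKt : extChartAt I x₀ '' C ⊆ (extChartAt I x₀).target :=
    Set.image_subset_iff.2 fun z hz ↦ (extChartAt I x₀).map_source (hCx hz)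
  have h1 := ((continuousOn_density_mul (g := g) (x₀ := x₀) hf).mono hKt).integrableOn_compact
    (μ := (Measure.addHaar : Measure E)) hK
  refine h1.of_forall_sdiff_eq_zero (isOpen_extChartAt_target x₀).measurableSet fun p hp ↦ ?_
  rw [h0, mul_zero]
  exact fun h ↦ hp.2 ⟨_, h, (extChartAt I x₀).right_inv hp.1⟩

theorem chartIntegral_sum {ι : Type*} [Fintype ι] {f : ι → M → ℝ} (hf : ∀ i, Continuous (f i))
    (h0 : ∀ i, ∀ x ∉ C, f i x = 0) :
    chartIntegral g x₀ (fun x ↦ ∑ i, f i x) = ∑ i, chartIntegral g x₀ (f i) := by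
  simp only [chartIntegral, Finset.mul_sum]
  exact integral_finsetSum _ fun i _ ↦ integrableOn_density_mul hC hCx (hf i) (h0 i)

/-- A nonnegative integrand with zero integral vanishes almost everywhere, hence everywhere on the
open target by continuity; the density is positive. -/
theorem eq_zero_of_chartIntegral_eq_zero {f : M → ℝ} (hf : Continuous f) (h0 : ∀ x ∉ C, f x = 0)
    (hpos : ∀ x, 0 ≤ f x) (h : chartIntegral g x₀ f = 0) (x : M) : f x = 0 := by
  by_cases hx : x ∈ C
  swap
  · exact h0 x hx
  have hG := isMetricOn_chartMetric g x₀
  have h1 := (setIntegral_eq_zero_iff_of_nonneg_ae ?_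
    (integrableOn_density_mul (g := g) hC hCx hf h0)).1 h
  · have h2 := Measure.eqOn_open_of_ae_eq h1 hG.isOpen (continuousOn_density_mul hf)
      continuousOn_const ((extChartAt I x₀).map_source (hCx hx))
    simp only [(extChartAt I x₀).left_inv (hCx hx), Pi.zero_apply] at h2
    exact (mul_eq_zero.1 h2).resolve_left (hG.density_pos ((extChartAt I x₀).map_source (hCx hx))).ne'
  · exact .of_forall fun p ↦ mul_nonneg (Real.sqrt_nonneg _) (hpos _)

end Compact

theorem divergence_sum {ι : Type*} [Fintype ι] {X : ι → Π x : M, TangentSpace I x}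
    (hX : ∀ i, CMDiff ∞ (T% (X i))) (x : M) :
    divergence g (fun y ↦ ∑ i, X i y) x = ∑ i, divergence g (X i) x := by
  refine forall_of_forall_chart I (P := fun x ↦
    divergence g (fun y ↦ ∑ i, X i y) x = ∑ i, divergence g (X i) x) (fun x₀ p hp ↦ ?_) x
  have hd (i) : MDiffAt (T% (X i)) ((extChartAt I x₀).symm p) :=
    (hX i _).mdifferentiableAt (by simp)
  have h : chartField x₀ (fun y ↦ ∑ i, X i y) = fun q ↦ ∑ i, chartField x₀ (X i) q := by
    funext q
    exact map_sum (chartCoframe I x₀ q) _ _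
  have hs : CMDiff ∞ (T% (fun y ↦ ∑ i, X i y)) := ContMDiff.sum_section fun i _ ↦ hX i
  rw [divergence_eq_coord hp ((hs _).mdifferentiableAt (by simp)), h, Coord.divergence,
    fderiv_fun_sum fun i _ ↦ differentiableAt_chartField hp (hd i)]
  simp only [divergence_eq_coord hp (hd _), Coord.divergence, Finset.sum_add_distrib, map_sum]
  simp

/-- A function on a closed manifold which is nonnegative and a divergence vanishes. -/
theorem eq_zero_of_eq_divergence [T2Space M] [CompactSpace M] {X : Π x : M, TangentSpace I x}
    (hX : CMDiff ∞ (T% X)) {f : M → ℝ} (hpos : ∀ x, 0 ≤ f x) (c : ℝ)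
    (hf : ∀ x, f x = c * divergence g X x) (x : M) : f x = 0 := by
  obtain ⟨t, ht⟩ := CompactSpace.elim_nhds_subcover (fun x : M ↦ (chartAt H x).source)
    fun x ↦ chart_source_mem_nhds H x
  obtain ⟨ρ, hρ⟩ := SmoothPartitionOfUnity.exists_isSubordinate I (isClosed_univ (X := M))
    (fun i : t ↦ (chartAt H (i : M)).source) (fun i ↦ (chartAt H _).open_source) (by
      intro y _
      obtain ⟨i, hi, hy⟩ := Set.mem_iUnion₂.1 (ht.ge (Set.mem_univ y))
      exact Set.mem_iUnion.2 ⟨⟨i, hi⟩, hy⟩)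
  have hsub (i : t) : tsupport (ρ i) ⊆ (extChartAt I (i : M)).source := by
    rw [extChartAt_source]
    exact hρ i
  have hsum (x : M) : ∑ i, ρ i x = 1 := by
    rw [← finsum_eq_sum_of_fintype]
    exact ρ.sum_eq_one (Set.mem_univ x)
  have hcpt (i : t) : IsCompact (tsupport (ρ i)) := (isClosed_tsupport _).isCompact
  have hρX (j : t) : CMDiff ∞ (T% (fun y ↦ ρ j y • X y)) :=
    fun y ↦ ((ρ j).contMDiff y).smul_section (hX y)
  have hdiv0 (j : t) (y : M) (hy : y ∉ tsupport (ρ j)) :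
      divergence g (fun y ↦ ρ j y • X y) y = 0 := by
    refine divergence_eq_zero_of_eventually ((hρX j y).mdifferentiableAt (by simp)) ?_
    filter_upwards [(isClosed_tsupport _).isOpen_compl.mem_nhds hy] with z hz
    rw [image_eq_zero_of_notMem_tsupport hz, zero_smul]
  have hcont : Continuous f := by
    rw [funext hf]
    exact continuous_const.mul (continuous_divergence hX)
  have hcij (i j : t) : Continuous fun y ↦ ρ i y * divergence g (fun y ↦ ρ j y • X y) y :=
    (ρ i).contMDiff.continuous.mul (continuous_divergence (hρX j))
  have hρ0 (i : t) (y : M) (hy : y ∉ tsupport (ρ i)) : ρ i y = 0 :=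
    image_eq_zero_of_notMem_tsupport hy
  -- Split `X = ∑ ρ_j X`. A term carrying both `ρ_i` and `ρ_j` lives in both charts and can be
  -- integrated in chart `j` instead of `i`; summing over `i` first then leaves a field compactly
  -- supported in one chart.
  have hzero : ∑ i : t, chartIntegral g (i : M) (fun y ↦ ρ i y * divergence g X y) = 0 := by
    calc ∑ i : t, chartIntegral g (i : M) (fun y ↦ ρ i y * divergence g X y)
        = ∑ i : t, ∑ j : t,
            chartIntegral g (i : M) (fun y ↦ ρ i y * divergence g (fun y ↦ ρ j y • X y) y) := by
          refine Finset.sum_congr rfl fun i _ ↦ ?_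
          rw [← chartIntegral_sum (hcpt i) (hsub i) (hcij i) fun j y hy ↦ by
            rw [hρ0 i y hy, zero_mul]]
          congr 1
          funext y
          rw [← Finset.mul_sum, ← divergence_sum hρX]
          congr 2
          funext z
          rw [← Finset.sum_smul, hsum, one_smul]
      _ = ∑ i : t, ∑ j : t,
            chartIntegral g (j : M) (fun y ↦ ρ i y * divergence g (fun y ↦ ρ j y • X y) y) := by
          refine Finset.sum_congr rfl fun i _ ↦ Finset.sum_congr rfl fun j _ ↦ ?_
          refine chartIntegral_congr_of_support fun y hy ↦ ⟨hsub i ?_, hsub j ?_⟩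
          · by_contra h
            exact left_ne_zero_of_mul hy (hρ0 i y h)
          · by_contra h
            exact right_ne_zero_of_mul hy (hdiv0 j y h)
      _ = ∑ j : t, chartIntegral g (j : M) (divergence g (fun y ↦ ρ j y • X y)) := by
          rw [Finset.sum_comm]
          refine Finset.sum_congr rfl fun j _ ↦ ?_
          rw [← chartIntegral_sum (hcpt j) (hsub j) (fun i ↦ hcij i j) fun i y hy ↦ by
            rw [hdiv0 j y hy, mul_zero]]
          congr 1
          funext y
          rw [← Finset.sum_mul, hsum, one_mul]
      _ = 0 := Finset.sum_eq_zero fun j _ ↦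
          chartIntegral_divergence_eq_zero (hcpt j) (hsub j) (hρX j) fun y hy ↦ by
            rw [hρ0 j y hy, zero_smul]
  have hzero' : ∑ i : t, chartIntegral g (i : M) (fun y ↦ ρ i y * f y) = 0 := by
    rw [← mul_zero c, ← hzero, Finset.mul_sum]
    refine Finset.sum_congr rfl fun i _ ↦ ?_
    rw [chartIntegral, chartIntegral, ← integral_const_mul]
    simp only [hf]
    congr 1
    funext p
    ring
  have hnn (i : t) (y : M) : 0 ≤ ρ i y * f y := mul_nonneg (ρ.nonneg i y) (hpos y)
  rw [Finset.sum_eq_zero_iff_of_nonneg fun i _ ↦ integral_nonneg fun p ↦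
    mul_nonneg (Real.sqrt_nonneg _) (hnn i _)] at hzero'
  rw [← one_mul (f x), ← hsum x, Finset.sum_mul]
  exact Finset.sum_eq_zero fun i hi ↦ eq_zero_of_chartIntegral_eq_zero (hcpt i) (hsub i)
    ((ρ i).contMDiff.continuous.mul hcont) (fun y hy ↦ mul_eq_zero_of_left (hρ0 i y hy) _) (hnn i)
    (hzero' i hi) x

end DivergenceTheorem

end AlmostHermitianGeometry

namespace AlmostHermitianGeometry

/-! ### Structures with a Lee form on closed manifolds -/

/-- The identity for `s - s*` makes `(n-1)²|T|²` a multiple of `div S.leeField`, so it vanishes. For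
`n = 1` this carries no information, but then `|∇J|² = 2(n-1)|T|²` is zero anyway. -/
theorem HermitianStructure.IsLeeField.isKahler {E : Type*} [NormedAddCommGroup E]
    [NormedSpace ℝ E] [FiniteDimensional ℝ E] [MeasurableSpace E] [BorelSpace E]
    {H : Type*} [TopologicalSpace H] {I : ModelWithCorners ℝ E H} [I.Boundaryless]
    {M : Type*} [TopologicalSpace M] [ChartedSpace H M] [IsManifold I ∞ M] [T2Space M]
    [CompactSpace M] {g : SmoothMetric I M} {S : HermitianStructure g} {n : ℕ}
    (hn : Module.finrank ℝ E = 2 * n) {T : Π x : M, TangentSpace I x} (hT : S.IsLeeField T)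
    (hSC : S.IsSC) : S.IsKahler := by
  refine isKahler_of_nablaJNormSq fun x ↦ ?_
  rw [hT.nablaJNormSq_eq hn]
  have hf (x : M) : ((n : ℝ) - 1) ^ 2 * g.inner x (T x) (T x) = -2 * divergence g S.leeField x := by
    have h := hT.scal_sub_scalStar hn x
    rw [hSC x, sub_self] at h
    linarith
  have h := eq_zero_of_eq_divergence S.contMDiff_leeField (fun x ↦ mul_nonneg (sq_nonneg _)
    ((S.isHermitianDeriv x).inner_self_nonneg (T x))) (-2) hf x
  rcases eq_or_ne ((n : ℝ) - 1) 0 with h0 | h0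
  · rw [h0, mul_zero, zero_mul]
  · rw [(mul_eq_zero.1 h).resolve_left (pow_ne_zero 2 h0), mul_zero]

end AlmostHermitianGeometry

end

open AlmostHermitianGeometry in
theorem mainTheorem4 {n : ℕ} {M : Type*} [TopologicalSpace M] [T2Space M]
    [SecondCountableTopology M] [ChartedSpace (EuclideanSpace ℝ (Fin (2 * n))) M]
    [IsManifold (𝓡 (2 * n)) ∞ M] (g : SmoothMetric (𝓡 (2 * n)) M) (S : HermitianStructure g) :
    -- nearly Kähler case
    ((S.IsW1 → ∀ x : M, scal g x - scalStar g S.J x = nablaJNormSq g S.J x) ∧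
      (S.IsNearlyKahler → S.IsSC → S.IsKahler)) ∧
    -- almost Kähler case
    ((S.IsW2 → ∀ x : M, 2 * (scal g x - scalStar g S.J x) = -nablaJNormSq g S.J x) ∧
      (S.IsAlmostKahler → S.IsSC → S.IsKahler)) ∧
    (S.IsW3 → S.IsSC) ∧
    -- locally conformally Kähler case
    ((∀ θ : Π x : M, TangentSpace (𝓡 (2 * n)) x →L[ℝ] ℝ, S.IsW4With θ → ∀ x : M,
        2 * ((n : ℝ) - 1) * divergence g (sharp g θ) x =
          -(scal g x - scalStar g S.J x) + ((n : ℝ) - 1) ^ 2 * oneFormNormSq g θ x) ∧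
      (CompactSpace M → S.IsW4 → S.IsSC → S.IsKahler) ∧
      (CompactSpace M → S.IsLCK → S.IsSC → S.IsKahler)) := by
  have hn : Module.finrank ℝ (EuclideanSpace ℝ (Fin (2 * n))) = 2 * n := finrank_euclideanSpace_fin
  refine ⟨⟨fun h ↦ h.scal_sub_scalStar, fun h hSC ↦ ?_⟩, ⟨fun h ↦ h.scal_sub_scalStar,
    fun h hSC ↦ ?_⟩, fun h ↦ h.isSC, fun _ h ↦ h.divergence_sharp hn, fun _ ⟨_, h⟩ hSC ↦
    h.isLeeField.isKahler hn hSC, fun _ h hSC ↦ ?_⟩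
  · refine HermitianStructure.isKahler_of_nablaJNormSq fun x ↦ ?_
    rw [← h.isW1.scal_sub_scalStar, hSC, sub_self]
  · refine HermitianStructure.isKahler_of_nablaJNormSq fun x ↦ ?_
    rw [← neg_eq_zero, ← h.isW2.scal_sub_scalStar, hSC, sub_self, mul_zero]
  · obtain ⟨T, hT⟩ := h.exists_isLeeField
    exact hT.isKahler hn hSC
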